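/- **Theorem (bi-valued utilities).** Let $N=\{1,\dots,n\}$ be a set of agents and $O=\{o_1,\dots,o_n\}$ a set of items, and let $u_{ij}$ be the utility of agent $i$ for item $o_j$. Assume the utilities are bi-valued: for each $i$ there are $\alpha_i>\beta_i\ge 0$ with $u_{ij}\in\{\alpha_i,\beta_i\}$ for all $j$, where $\alpha_i$ is attained by some item (so an agent indifferent between all items values them all at $\alpha_i$). Let $D_i=\{o_j: u_{ij}=\alpha_i\}$ be the set of most preferred items of $i$, and let $u'$ be the binary-reduced utilities: $u'_{ij}=1$ if $u_{ij}=\alpha_i$ and $u'_{ij}=0$ otherwise. *Assignments.* An assignment is a matrix $x\in[0,1]^{n\times n}$ with $\sum_i x_{ij}=1$ for all $j$; it is balanced if moreover every row has size $\sum_j x_{ij}=1$. A balanced allocation is a vector $a\in[0,1]^n$ with $\sum_j a_j=1$. Utilities are additive: $u_i(x_i)=\sum_j x_{ij}u_{ij}$. *HZ and CEEI.* Given a consumption set $K$ and prices $p\in\mathbb R^n_{\ge0}$, call $a\in K$ a cheapest demand of agent $i$ if $p\cdot a\le 1$, $u_i(a)\ge u_i(b)$ for all $b\in K$ with $p\cdot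 b\le1$, and $p\cdot a\le p\cdot b$ for all $b\in K$ with $u_i(b)\ge u_i(a)$. An HZ solution is a balanced assignment $x$ for which there are prices $p\ge0$ such that each $x_i$ is a cheapest demand of $i$, where $K$ is the set of balanced allocations. A CEEI solution is an assignment $x$ for which there are prices $p\ge 0$ such that each $x_i$ is a cheapest demand of $i$, where $K=\mathbb R^n_{\ge0}$. *Welfarist rules.* On a set of assignments, an MNW solution maximizes $\prod_i u_i(x_i)$. A leximin solution is one for which no other member of the set has a utility profile that, sorted in nondecreasing order, is lexicographically larger than its own sorted profile. The egalitarian rule returns the balanced assignments whose utility profile Lorenz dominates that of every balanced assignment, that is, for each $k$ the sum of the $k$ smallest utilities is at least as large. *Balancing.* Balancing an assignment $x$ means: each agent with size greater than $1$ gives away shares, least preferred items first, until her size is $1$; the donated shares are distributed arbitrarily among the agents with size less than $1$ so that all sizes become $1$; agents with size $1$ are unaffected. *EPS.* Start with $N'=N$, $O'=O$. While $N'\neq\emptyset$: if all agents $i\in N'$ can simultaneously be given one unit of items from $D_i\cap O'$, do so and stop. Otherwise let $v=\min_{\emptyset\ne C\subseteq N'}|\bigcup_{i\in C}(D_i\cap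 O')|/|C|$, let $X$ be a minimizer of largest cardinality, give each $i\in X$ exactly $v$ units of items from $D_i\cap O'$, and remove $X$ from $N'$ and $\bigcup_{i\in X}(D_i\cap O')$ from $O'$. At the end, give the unallocated shares to the agents with size less than $1$ so that the assignment becomes balanced. Two rules are *equivalent* on the instance if both have at least one outcome and every outcome of the one gives each agent the same utility (with respect to $u$) as every outcome of the other. Then the HZ rule (for the utilities $u$) is equivalent to each of the following rules: 1. the EPS rule; 2. the egalitarian rule with respect to $u'$; 3. leximin with respect to $u'$ on the set of balanced assignments; 4. MNW with respect to $u'$ on the set of balanced assignments; 5. balancing a leximin solution with respect to $u'$ (over all assignments); 6. balancing an MNW solution with respect to $u'$ (over all assignments); 7. balancing a CEEI solution with respect to $u'$. -/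

import Mathlib

noncomputable section

namespace RandomAssignment

variable {n : ℕ}

/-- A matrix of shares or of utilities: rows are the `n` agents, columns are the `n` items. -/
abbrev Mat (n : ℕ) := Fin n → Fin n → ℝ

/-! ### Assignments -/

/-- The size of an allocation (a row). -/
def size (a : Fin n → ℝ) : ℝ := ∑ j, a j

/-- Additive value of an allocation `a` for an agent with item values `w`. -/
def value (w a : Fin n → ℝ) : ℝ := ∑ j, a j * w j

/-- Cost of an allocation at prices `p`. -/
def cost (p a : Fin n → ℝ) : ℝ := ∑ j, p j * a j

/-- Expected utility of agent `i` from the assignment `x`. -/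
def util (u x : Mat n) (i : Fin n) : ℝ := value (u i) (x i)

/-- Fractional assignments: every item is fully distributed (so all shares lie in `[0,1]`). -/
def assignments (n : ℕ) : Set (Mat n) :=
  {x | (∀ i j, x i j ∈ Set.Icc (0 : ℝ) 1) ∧ ∀ j, ∑ i, x i j = 1}

/-- Balanced allocations: shares in `[0,1]`, one unit in total. -/
def balancedAllocations (n : ℕ) : Set (Fin n → ℝ) :=
  {a | (∀ j, a j ∈ Set.Icc (0 : ℝ) 1) ∧ size a = 1}

/-- Balanced fractional assignments: moreover every agent gets one unit in total. -/
def balancedAssignments (n : ℕ) : Set (Mat n) :=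
  {x | x ∈ assignments n ∧ ∀ i, size (x i) = 1}

/-! ### Bi-valued utilities -/

/-- Bi-valued utilities: agent `i` values every item at `α i` or at `β i`, where
`α i > β i ≥ 0`, and `α i` is the value of her most preferred items (so an agent who is
indifferent between all items values them all at `α i`). -/
structure IsBivalued (u : Mat n) (α β : Fin n → ℝ) : Prop where
  lt : ∀ i, β i < α i
  nonneg : ∀ i, 0 ≤ β i
  mem : ∀ i j, u i j = α i ∨ u i j = β i
  attained : ∀ i, ∃ j, u i j = α i

/-- Binary-reduced utilities: `α i` is turned into `1` and `β i` into `0`. -/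
def binaryReduced (u : Mat n) (α : Fin n → ℝ) : Mat n :=
  fun i j => if u i j = α i then 1 else 0

/-- The set of items most preferred by agent `i`. -/
def topItems (u : Mat n) (i : Fin n) : Finset (Fin n) :=
  Finset.univ.filter fun j => ∀ k, u i k ≤ u i j

/-! ### Competitive rules -/

/-- `a` is a utility-maximal allocation from the consumption set `K` at prices `p` with budget
`1`, and it is a cheapest allocation in `K` among those with at least that utility. -/
structure IsCheapestDemand (K : Set (Fin n → ℝ)) (w p a : Fin n → ℝ) : Prop where
  mem : a ∈ K
  affordable : cost p a ≤ 1
  optimal : ∀ b ∈ K, cost p b ≤ 1 → value w b ≤ value w a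
  cheapest : ∀ b ∈ K, value w a ≤ value w b → cost p a ≤ cost p b

/-- Hylland–Zeckhauser solutions. -/
def IsHZ (u x : Mat n) : Prop :=
  x ∈ balancedAssignments n ∧
    ∃ p : Fin n → ℝ, (∀ j, 0 ≤ p j) ∧
      ∀ i, IsCheapestDemand (balancedAllocations n) (u i) p (x i)

/-- Competitive equilibrium with equal incomes. Demand is unconstrained: an agent may demand any
nonnegative quantity of each item; feasibility comes only from market clearing. -/
def IsCEEI (u x : Mat n) : Prop :=
  x ∈ assignments n ∧
    ∃ p : Fin n → ℝ, (∀ j, 0 ≤ p j) ∧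
      ∀ i, IsCheapestDemand {a | ∀ j, 0 ≤ a j} (u i) p (x i)

/-! ### Welfarist rules, on a set `F` of feasible assignments -/

/-- Maximum Nash welfare on `F`. -/
def IsMNW (F : Set (Mat n)) (u x : Mat n) : Prop :=
  x ∈ F ∧ ∀ y ∈ F, ∏ i, util u y i ≤ ∏ i, util u x i

/-- The entries of `v` in nondecreasing order. -/
def sortUp (v : Fin n → ℝ) : Fin n → ℝ := v ∘ Tuple.sort v

/-- Leximin dominance: at the first difference of the sorted vectors, `v` is larger. -/
def LeximinDominates (v w : Fin n → ℝ) : Prop :=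
  ∃ i, (∀ j < i, sortUp v j = sortUp w j) ∧ sortUp w i < sortUp v i

/-- Leximin optimality on `F`. -/
def IsLeximin (F : Set (Mat n)) (u x : Mat n) : Prop :=
  x ∈ F ∧ ¬ ∃ y ∈ F, LeximinDominates (util u y) (util u x)

/-- Lorenz dominance: for every `k`, the `k` smallest entries of `v` have at least the same sum as
the `k` smallest entries of `w`. -/
def LorenzDominates (v w : Fin n → ℝ) : Prop :=
  ∀ k : ℕ, ∑ i with i.val < k, sortUp w i ≤ ∑ i with i.val < k, sortUp v i

/-- The egalitarian rule of Bogomolnaia and Moulin: balanced assignments whose utility profile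
Lorenz dominates the utility profile of every balanced assignment. -/
def IsEgalitarian (u x : Mat n) : Prop :=
  x ∈ balancedAssignments n ∧
    ∀ y ∈ balancedAssignments n, LorenzDominates (util u x) (util u y)

/-! ### The balancing operation -/

/-- `y` arises from the assignment `x` by the balancing operation: an agent with more than one
unit gives away least preferred items first until she holds one unit, and the donated shares go
in an arbitrary way to the agents with less than one unit, who end up with one unit. -/
structure IsBalancing (u x y : Mat n) : Prop where
  balanced : y ∈ balancedAssignments n
  unchanged : ∀ i, size (x i) = 1 → y i = x i
  gives : ∀ i, 1 < size (x i) → ∀ j, y i j ≤ x i j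
  /-- an item is given away only after all shares of strictly less preferred items -/
  least_first : ∀ i, 1 < size (x i) →
    ∀ j k, u i j < u i k → y i k < x i k → y i j = 0
  receives : ∀ i, size (x i) < 1 → ∀ j, x i j ≤ y i j

/-! ### Extended probabilistic serial for dichotomous preferences

`D i` is the set of liked items of agent `i`; `A` and `R` are the agents and items still in the
market. -/

/-- `y` gives each agent in `A` exactly `v` units of liked items in `R`, nothing to the other
agents, and at most one unit of each item in total. -/
structure GivesEach (D : Fin n → Finset (Fin n)) (A R : Finset (Fin n)) (v : ℝ)
    (y : Mat n) : Prop where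
  nonneg : ∀ i j, 0 ≤ y i j
  supported : ∀ i j, y i j ≠ 0 → i ∈ A ∧ j ∈ D i ∩ R
  supply : ∀ j, ∑ i, y i j ≤ 1
  amount : ∀ i ∈ A, size (y i) = v

/-- The items in `R` liked by some agent in `C`. -/
def likedBy (D : Fin n → Finset (Fin n)) (R C : Finset (Fin n)) : Finset (Fin n) :=
  C.biUnion fun i => D i ∩ R

/-- Number of available liked items per agent in `C`. -/
def ratio (D : Fin n → Finset (Fin n)) (R C : Finset (Fin n)) : ℝ :=
  ((likedBy D R C).card : ℝ) / (C.card : ℝ)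

/-- `X` is a nonempty set of agents in `A` that minimizes `ratio` and has the largest cardinality
among the minimizers. -/
structure IsBottleneck (D : Fin n → Finset (Fin n)) (A R X : Finset (Fin n)) : Prop where
  subset : X ⊆ A
  nonempty : X.Nonempty
  minimal : ∀ C ⊆ A, C.Nonempty → ratio D R X ≤ ratio D R C
  largest : ∀ C ⊆ A, C.Nonempty → ratio D R C = ratio D R X → C.card ≤ X.card

/-- `EPSLoop D A R x`: started with remaining agents `A` and remaining items `R`, the main loop of
the algorithm can hand out the shares `x`. -/
inductive EPSLoop (D : Fin n → Finset (Fin n)) :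
    Finset (Fin n) → Finset (Fin n) → Mat n → Prop
  | done (R : Finset (Fin n)) : EPSLoop D ∅ R 0
  | saturate (A R : Finset (Fin n)) (y : Mat n) (hA : A.Nonempty)
      (hy : GivesEach D A R 1 y) : EPSLoop D A R y
  | bottleneck (A R X : Finset (Fin n)) (y z : Mat n) (hA : A.Nonempty)
      (hsat : ¬ ∃ y', GivesEach D A R 1 y') (hX : IsBottleneck D A R X)
      (hy : GivesEach D X R (ratio D R X) y)
      (hz : EPSLoop D (A \ X) (R \ likedBy D R X) z) : EPSLoop D A R (y + z)

/-- Outcomes of the EPS rule: after the loop, the unallocated shares are given to the agents with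
less than one unit so as to obtain a balanced assignment. -/
def IsEPS (u x : Mat n) : Prop :=
  x ∈ balancedAssignments n ∧
    ∃ y, EPSLoop (topItems u) Finset.univ Finset.univ y ∧ ∀ i j, y i j ≤ x i j

/-! ### Equivalence of rules -/

/-- Two rules, given by their sets of outcomes on the instance with utilities `u`, are equivalent
there: both have an outcome, and any two outcomes give every agent the same utility. -/
def RulesEquivalent (u : Mat n) (S T : Set (Mat n)) : Prop :=
  S.Nonempty ∧ T.Nonempty ∧ ∀ x ∈ S, ∀ y ∈ T, ∀ i, util u x i = util u y i

end RandomAssignment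

end

/-! Everything is measured against one assignment `e` that is stable under transfers: the holder of
an item that somebody likes also likes it, and is no better off than anyone else who likes it. A
maximizer of a strictly concave, increasing, symmetric function of the utilities is stable
(`exists_isTransferStable`). The agents with utility at most `t` jointly own every item that one of
them likes, so `e` maximizes each sum `∑ i, min (util w y i) t`; this yields Lorenz dominance.
Pricing an item at the reciprocal utility of a holder who likes it, and at `0` if nobody does, makes
`e` a CEEI solution.

Balanced assignments give reduced utility at most `1`, so the common profile of all the rules is
that of `e` truncated at `1`. Balancing attains it, a balanced assignment that is at least as good
for everybody has exactly this profile (`IsTransferStable.util_eq_of_le`), and cancelling the prices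
that are at most `1` supports it as an HZ solution (`IsTransferStable.isHZ`).

Uniqueness comes from Nash welfare. A competitive solution `x` satisfies `∑ i, util w y i / util w x
i ≤ n` for all feasible `y`, the first-order condition for a maximal product, and `r ≤ exp (r - 1)`
with its equality case shows that only one profile attains that maximum. Leximin and Lorenz optima
share its sorted profile, hence its product. The EPS loop peels off the utility levels of `e` from
below until they reach `1`. Finally, on allocations of size one `u` is an increasing affine function
of the reduced utilities, which transfers HZ and all conclusions to `u`. -/

namespace RandomAssignment

open Finset

/-! ### Lorenz, leximin and Nash comparison of utility profiles -/

section Profiles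

variable {n : ℕ}

theorem sum_sortUp_comp (v : Fin n → ℝ) (f : ℝ → ℝ) : ∑ i, f (sortUp v i) = ∑ i, f (v i) :=
  Equiv.sum_comp (Tuple.sort v) fun i => f (v i)

theorem prod_sortUp (v : Fin n → ℝ) : ∏ i, sortUp v i = ∏ i, v i :=
  Equiv.prod_comp (Tuple.sort v) v

theorem sortUp_monotone (v : Fin n → ℝ) : Monotone (sortUp v) :=
  Tuple.monotone_sort v

theorem prod_eq_of_sortUp_eq {v w : Fin n → ℝ} (h : sortUp v = sortUp w) :
    ∏ i, v i = ∏ i, w i := by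
  rw [← prod_sortUp v, h, prod_sortUp]

/-- If `v` dominates `w` for all the functions `min · t`, then it Lorenz dominates `w`. -/
theorem lorenzDominates_of_sum_min_le {v w : Fin n → ℝ}
    (h : ∀ t, ∑ i, min (w i) t ≤ ∑ i, min (v i) t) : LorenzDominates v w := by
  intro k
  rcases Nat.eq_zero_or_pos k with rfl | hk
  · simp
  rcases Nat.eq_zero_or_pos n with rfl | hn
  · simp
  -- Threshold at the `k`-th smallest entry of `w`, or the largest one if `k > n`: truncation at `t`
  -- then leaves the first `k` entries of `w` unchanged and turns the others into `t`.
  let m : Fin n := ⟨min k n - 1, by omega⟩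
  set t := sortUp w m with ht
  have hle : ∀ i : Fin n, i.val < k → sortUp w i ≤ t := fun i hi =>
    sortUp_monotone w (Fin.le_def.2 (by simp only [m]; omega))
  have hge : ∀ i : Fin n, ¬ i.val < k → t ≤ sortUp w i := fun i hi =>
    sortUp_monotone w (Fin.le_def.2 (by simp only [m]; omega))
  have h1 := h t
  rw [← sum_sortUp_comp w fun r => min r t, ← sum_sortUp_comp v fun r => min r t,
    ← sum_filter_add_sum_filter_not univ (fun i : Fin n => i.val < k),
    ← sum_filter_add_sum_filter_not univ (fun i : Fin n => i.val < k)
      (fun i => min (sortUp v i) t)] at h1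
  have h2 : ∑ i with i.val < k, min (sortUp w i) t = ∑ i with i.val < k, sortUp w i :=
    sum_congr rfl fun i hi => min_eq_left (hle i (mem_filter.1 hi).2)
  have h3 : ∑ i : Fin n with ¬ i.val < k, min (sortUp w i) t = ∑ i : Fin n with ¬ i.val < k, t :=
    sum_congr rfl fun i hi => min_eq_right (hge i (mem_filter.1 hi).2)
  have h4 : ∑ i with i.val < k, min (sortUp v i) t ≤ ∑ i with i.val < k, sortUp v i :=
    sum_le_sum fun i _ => min_le_left _ _
  have h5 : ∑ i : Fin n with ¬ i.val < k, min (sortUp v i) t ≤ ∑ i : Fin n with ¬ i.val < k, t :=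
    sum_le_sum fun i _ => min_le_right _ _
  linarith

theorem sum_lt_succ_eq (f : Fin n → ℝ) (i : Fin n) :
    ∑ j with j.val < i.val + 1, f j = ∑ j with j < i, f j + f i := by
  have : (univ.filter fun j : Fin n => j.val < i.val + 1)
      = insert i (univ.filter fun j : Fin n => j < i) := by
    ext j
    simp only [mem_filter, mem_univ, true_and, mem_insert, Fin.ext_iff, Fin.lt_def]
    omega
  rw [this, sum_insert (by simp), add_comm]

theorem le_of_lorenzDominates {v w : Fin n → ℝ} (h : LorenzDominates v w) (i : Fin n)
    (hi : ∀ j < i, sortUp v j = sortUp w j) : sortUp w i ≤ sortUp v i := by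
  have h1 := h (i.val + 1)
  rw [sum_lt_succ_eq, sum_lt_succ_eq] at h1
  have h2 : ∑ j with j < i, sortUp v j = ∑ j with j < i, sortUp w j :=
    sum_congr rfl fun j hj => hi j (mem_filter.1 hj).2
  linarith

theorem LorenzDominates.not_leximinDominates {v w : Fin n → ℝ} (h : LorenzDominates v w) :
    ¬ LeximinDominates w v := by
  rintro ⟨i, hi, hlt⟩
  exact absurd (le_of_lorenzDominates h i fun j hj => (hi j hj).symm) (not_le.2 hlt)

/-- At the first difference of the sorted vectors the earlier entries cancel from the partial sums,
so the difference favours `v`. -/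
theorem LorenzDominates.sortUp_eq_or_leximinDominates {v w : Fin n → ℝ}
    (h : LorenzDominates v w) : sortUp v = sortUp w ∨ LeximinDominates v w := by
  by_contra! hc
  have key : ∀ i, sortUp v i = sortUp w i := by
    intro i
    induction i using WellFoundedLT.induction with
    | ind i ih =>
      rcases (le_of_lorenzDominates h i ih).eq_or_lt with he | hl
      · exact he.symm
      · exact absurd ⟨i, ih, hl⟩ hc.2
  exact hc.1 (funext key)

/-- AM-GM for the ratios `w i / v i`, through `r ≤ exp (r - 1)`. -/
theorem prod_le_prod_of_sum_div_le {v w : Fin n → ℝ} (hv : ∀ i, 0 < v i) (hw : ∀ i, 0 ≤ w i)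
    (h : ∑ i, w i / v i ≤ n) : ∏ i, w i ≤ ∏ i, v i := by
  have h1 : ∏ i, w i / v i ≤ 1 :=
    calc ∏ i, w i / v i ≤ ∏ i, Real.exp (w i / v i - 1) :=
          prod_le_prod (fun i _ => div_nonneg (hw i) (hv i).le)
            fun i _ => by linarith [Real.add_one_le_exp (w i / v i - 1)]
      _ = Real.exp (∑ i, w i / v i - n) := by rw [← Real.exp_sum]; simp
      _ ≤ 1 := Real.exp_le_one_iff.2 (by linarith)
  rw [prod_div_distrib] at h1
  exact (div_le_one (prod_pos fun i _ => hv i)).1 h1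

/-- Equality case: `r < exp (r - 1)` as soon as one ratio differs from `1`. All uniqueness
statements rest on this. -/
theorem eq_of_prod_le_of_sum_div_le {v w : Fin n → ℝ} (hv : ∀ i, 0 < v i) (hw : ∀ i, 0 ≤ w i)
    (h : ∑ i, w i / v i ≤ n) (hp : ∏ i, v i ≤ ∏ i, w i) : w = v := by
  by_contra hne
  obtain ⟨k, hk⟩ := Function.ne_iff.1 hne
  have hpos : 0 < ∏ i, v i := prod_pos fun i _ => hv i
  have hw' : ∀ i, 0 < w i := fun i =>
    (hw i).lt_of_ne' (prod_ne_zero_iff.1 (hpos.trans_le hp).ne' i (mem_univ i))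
  have hk' : w k / v k - 1 ≠ 0 := by
    intro h0
    exact hk ((div_eq_one_iff_eq (hv k).ne').1 (by linarith))
  have h1 : ∏ i, w i / v i < 1 :=
    calc ∏ i, w i / v i < ∏ i, Real.exp (w i / v i - 1) :=
          prod_lt_prod (fun i _ => div_pos (hw' i) (hv i))
            (fun i _ => by linarith [Real.add_one_le_exp (w i / v i - 1)])
            ⟨k, mem_univ k, by linarith [Real.add_one_lt_exp hk']⟩
      _ = Real.exp (∑ i, w i / v i - n) := by rw [← Real.exp_sum]; simp
      _ ≤ 1 := Real.exp_le_one_iff.2 (by linarith)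
  rw [prod_div_distrib, div_lt_one hpos] at h1
  exact absurd hp (not_le.2 h1)

/-- `v` maximizes, among the profiles `util w y` with `y ∈ F`, the linearization at `v` of the
Nash welfare as well as all sums of truncated utilities. -/
structure IsFairest (F : Set (Mat n)) (w : Mat n) (v : Fin n → ℝ) : Prop where
  pos : ∀ i, 0 < v i
  nash : ∀ y ∈ F, ∑ i, util w y i / v i ≤ n
  sum_min : ∀ y ∈ F, ∀ t, ∑ i, min (util w y i) t ≤ ∑ i, min (v i) t
  nonneg : ∀ y ∈ F, ∀ i, 0 ≤ util w y i

namespace IsFairest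

variable {F : Set (Mat n)} {w x z : Mat n} {v : Fin n → ℝ}

theorem lorenz (h : IsFairest F w v) {y : Mat n} (hy : y ∈ F) : LorenzDominates v (util w y) :=
  lorenzDominates_of_sum_min_le (h.sum_min y hy)

theorem isMNW (h : IsFairest F w v) (hx : x ∈ F) (hv : util w x = v) : IsMNW F w x := by
  refine ⟨hx, fun y hy => ?_⟩
  rw [hv]
  exact prod_le_prod_of_sum_div_le h.pos (h.nonneg y hy) (h.nash y hy)

theorem isLeximin (h : IsFairest F w v) (hx : x ∈ F) (hv : util w x = v) : IsLeximin F w x := by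
  refine ⟨hx, ?_⟩
  rintro ⟨y, hy, hd⟩
  rw [hv] at hd
  exact (h.lorenz hy).not_leximinDominates hd

theorem eq_of_prod_le (h : IsFairest F w v) (hz : z ∈ F) (hp : ∏ i, v i ≤ ∏ i, util w z i) :
    util w z = v :=
  eq_of_prod_le_of_sum_div_le h.pos (h.nonneg z hz) (h.nash z hz) hp

theorem eq_of_isMNW (h : IsFairest F w v) (hx : x ∈ F) (hv : util w x = v) (hz : IsMNW F w z) :
    util w z = v :=
  h.eq_of_prod_le hz.1 (hv ▸ hz.2 x hx)

/-- Leximin optimality fixes a profile only up to permutation; since the product is then fixed too,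
uniqueness of the Nash optimum removes the permutation. -/
theorem eq_of_isLeximin (h : IsFairest F w v) (hx : x ∈ F) (hv : util w x = v)
    (hz : IsLeximin F w z) : util w z = v := by
  rcases (h.lorenz hz.1).sortUp_eq_or_leximinDominates with he | hl
  · exact h.eq_of_prod_le hz.1 (prod_eq_of_sortUp_eq he).le
  · exact absurd ⟨x, hx, hv ▸ hl⟩ hz.2

theorem eq_of_lorenzDominates (h : IsFairest F w v) (hz : z ∈ F)
    (hd : LorenzDominates (util w z) v) : util w z = v := by
  rcases (h.lorenz hz).sortUp_eq_or_leximinDominates with he | hl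
  · exact h.eq_of_prod_le hz (prod_eq_of_sortUp_eq he).le
  · exact absurd hl hd.not_leximinDominates

end IsFairest

end Profiles

/-! ### Dichotomous preferences and transfer stable assignments -/

section Stable

variable {n : ℕ}

/-- A `0`-`1` matrix without zero rows, that is, dichotomous preferences. -/
structure IsDichotomous (w : Mat n) : Prop where
  zero_or_one : ∀ i j, w i j = 0 ∨ w i j = 1
  exists_one : ∀ i, ∃ j, w i j = 1

namespace IsDichotomous

variable {w : Mat n}

theorem nonneg (hw : IsDichotomous w) (i j) : 0 ≤ w i j := by
  rcases hw.zero_or_one i j with h | h <;> simp [h]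

theorem le_one (hw : IsDichotomous w) (i j) : w i j ≤ 1 := by
  rcases hw.zero_or_one i j with h | h <;> simp [h]

theorem value_nonneg (hw : IsDichotomous w) {a : Fin n → ℝ} (ha : ∀ j, 0 ≤ a j) (i : Fin n) :
    0 ≤ value (w i) a :=
  sum_nonneg fun j _ => mul_nonneg (ha j) (hw.nonneg i j)

theorem value_le_size (hw : IsDichotomous w) {a : Fin n → ℝ} (ha : ∀ j, 0 ≤ a j) (i : Fin n) :
    value (w i) a ≤ size a :=
  sum_le_sum fun j _ => mul_le_of_le_one_right (ha j) (hw.le_one i j)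

end IsDichotomous

theorem isCompact_assignments (n : ℕ) : IsCompact (assignments n) := by
  have h1 : IsCompact (Set.pi Set.univ fun _ : Fin n => Set.pi Set.univ fun _ : Fin n =>
      Set.Icc (0 : ℝ) 1) :=
    isCompact_univ_pi fun _ => isCompact_univ_pi fun _ => isCompact_Icc
  have h2 : assignments n = (Set.pi Set.univ fun _ : Fin n => Set.pi Set.univ fun _ : Fin n =>
      Set.Icc (0 : ℝ) 1) ∩ {x | ∀ j, ∑ i, x i j = 1} := by
    ext x
    simp only [assignments, Set.mem_inter_iff, Set.mem_pi, Set.mem_univ, true_implies,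
      Set.mem_ofPred_eq]
  rw [h2]
  refine h1.inter_right ?_
  simp only [Set.ofPred_forall]
  refine isClosed_iInter fun j => isClosed_eq ?_ continuous_const
  fun_prop

theorem identity_mem_balancedAssignments (n : ℕ) :
    (fun i j => if i = j then 1 else 0 : Mat n) ∈ balancedAssignments n := by
  refine ⟨⟨fun i j => ?_, fun j => by simp⟩, fun i => by simp [size]⟩
  dsimp only
  split_ifs <;> simp

theorem mem_assignments_of_nonneg {x : Mat n} (h0 : ∀ i j, 0 ≤ x i j)
    (h1 : ∀ j, ∑ i, x i j = 1) : x ∈ assignments n :=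
  ⟨fun i j => ⟨h0 i j, (h1 j) ▸ single_le_sum (fun k _ => h0 k j) (mem_univ i)⟩, h1⟩

/-- No item held by an agent is liked by a worse-off agent, or by an arbitrary agent if its
holder does not like it. -/
structure IsTransferStable (w e : Mat n) : Prop where
  mem : e ∈ assignments n
  stable : ∀ i j k, 0 < e i j → w k j = 1 → w i j = 1 ∧ util w e i ≤ util w e k

/-- Agent `i` hands `ε` of item `j` over to agent `k`. -/
def transfer (e : Mat n) (i k j : Fin n) (ε : ℝ) : Mat n :=
  fun l m => e l m + (if m = j then ((if l = k then ε else 0) - (if l = i then ε else 0)) else 0)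

theorem transfer_mem {e : Mat n} (he : e ∈ assignments n) {i k : Fin n} (hik : i ≠ k) {j : Fin n}
    {ε : ℝ} (h0 : 0 ≤ ε) (hε : ε ≤ e i j) : transfer e i k j ε ∈ assignments n := by
  refine mem_assignments_of_nonneg (fun l m => ?_) fun m => ?_
  · have := (he.1 l m).1
    unfold transfer
    split_ifs <;> subst_vars <;> first | exact absurd rfl hik | linarith
  · simp only [transfer, sum_add_distrib, he.2 m]
    by_cases hm : m = j <;> simp [hm]

theorem util_transfer (w e : Mat n) (i k j : Fin n) (ε : ℝ) (l : Fin n) :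
    util w (transfer e i k j ε) l = util w e l +
      ε * (((if l = k then 1 else 0) - (if l = i then 1 else 0)) * w l j) := by
  simp only [util, value, transfer, add_mul, sum_add_distrib, ite_mul, zero_mul,
    sum_ite_eq', mem_univ, if_true]
  split_ifs <;> ring

theorem util_le (hw : IsDichotomous w) {e : Mat n} (he : e ∈ assignments n) (i : Fin n) :
    util w e i ≤ n := by
  calc util w e i ≤ ∑ j, e i j := hw.value_le_size (fun j => (he.1 i j).1) i
    _ ≤ ∑ _j : Fin n, (1 : ℝ) := sum_le_sum fun j _ => (he.1 i j).2
    _ = n := by simp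

/-- Stability is the first-order condition, along transfers of one item, at a maximizer of `∑ ((2 *
n + 1) * d - d ^ 2)`. The summand is increasing for `d ≤ n`, which covers all utilities, and being
quadratic it makes the effect of a transfer explicit. -/
theorem exists_isTransferStable {w : Mat n} (hw : IsDichotomous w) :
    ∃ e, IsTransferStable w e := by
  obtain ⟨e, he, hmax⟩ := (isCompact_assignments n).exists_isMaxOn
    ⟨_, (identity_mem_balancedAssignments n).1⟩
    (f := fun x => ∑ i, ((2 * n + 1) * util w x i - util w x i ^ 2))
    (by unfold util value; fun_prop)
  refine ⟨e, he, fun i j k hij hk => ?_⟩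
  by_cases hik : i = k
  · subst hik; exact ⟨hk, le_rfl⟩
  have hdi := util_le hw he i
  have hdk := util_le hw he k
  -- The gain from transferring `ε` is `ε` times the left side minus a second-order term of at most
  -- `2 * ε ^ 2`.
  have key : ∀ ε, 0 < ε → ε ≤ e i j →
      (2 * n + 1 - 2 * util w e k) - w i j * (2 * n + 1 - 2 * util w e i) ≤ 0 + 2 * ε := by
    intro ε h0 hε
    have h1 : ∑ l, ((2 * n + 1) * util w (transfer e i k j ε) l
          - util w (transfer e i k j ε) l ^ 2) ≤ ∑ l, ((2 * n + 1) * util w e l - util w e l ^ 2) :=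
      hmax (transfer_mem he hik h0.le hε)
    rw [← sub_nonpos, ← sum_sub_distrib] at h1
    have h2 : ∀ l, ((2 * n + 1) * util w (transfer e i k j ε) l
          - util w (transfer e i k j ε) l ^ 2) - ((2 * n + 1) * util w e l - util w e l ^ 2)
        = (if l = k then ε * (2 * n + 1 - 2 * util w e k) - ε ^ 2 else 0)
          + (if l = i then - (ε * w i j * (2 * n + 1 - 2 * util w e i)) - (ε * w i j) ^ 2
              else 0) := by
      intro l
      rw [util_transfer]
      by_cases hlk : l = k
      · subst hlk
        have : l ≠ i := fun h => hik h.symm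
        simp only [this, if_true, if_false, hk]
        ring
      · by_cases hli : l = i
        · subst hli
          simp only [hlk, if_true, if_false]
          ring
        · simp only [hlk, hli, if_false]
          ring
    simp only [h2, sum_add_distrib, sum_ite_eq', mem_univ, if_true] at h1
    have h3 : w i j ^ 2 ≤ 1 := by
      rcases hw.zero_or_one i j with h | h <;> simp [h]
    have h4 : ε * ((2 * n + 1 - 2 * util w e k) - w i j * (2 * n + 1 - 2 * util w e i))
        ≤ ε * (2 * ε) := by nlinarith [sq_nonneg ε]
    linarith [le_of_mul_le_mul_left h4 h0]
  -- The limit `ε → 0`, made finite by `ε ≤ a / 4`.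
  have key2 : (2 * n + 1 - 2 * util w e k) - w i j * (2 * n + 1 - 2 * util w e i) ≤ 0 := by
    by_contra! hpos
    set a := (2 * n + 1 - 2 * util w e k) - w i j * (2 * n + 1 - 2 * util w e i)
    have := key (min (e i j) (a / 4)) (lt_min hij (by linarith)) (min_le_left _ _)
    linarith [min_le_right (e i j) (a / 4)]
  -- A holder who does not like the item would force `2 * n + 1 ≤ 2 * util w e k`, against
  -- `util_le`.
  rcases hw.zero_or_one i j with h | h
  · rw [h] at key2
    linarith
  · rw [h] at key2
    exact ⟨h, by linarith⟩

theorem util_nonneg {w y : Mat n} (hw : IsDichotomous w) (hy : y ∈ assignments n) (i : Fin n) :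
    0 ≤ util w y i :=
  hw.value_nonneg (fun j => (hy.1 i j).1) i

theorem exists_holder {e : Mat n} (he : e ∈ assignments n) (j : Fin n) : ∃ i, 0 < e i j := by
  by_contra! h
  have := he.2 j
  linarith [sum_nonpos fun i (_ : i ∈ univ) => h i]

namespace IsTransferStable

variable {w e : Mat n}

/-- Some holder of an item liked by `k` likes it too, so has positive utility, and is no better off
than `k`. -/
theorem util_pos (hw : IsDichotomous w) (he : IsTransferStable w e) (k : Fin n) :
    0 < util w e k := by
  obtain ⟨j, hj⟩ := hw.exists_one k
  obtain ⟨i, hi⟩ := exists_holder he.mem j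
  obtain ⟨h1, h2⟩ := he.stable i j k hi hj
  refine lt_of_lt_of_le ?_ h2
  refine sum_pos' (fun m _ => mul_nonneg (he.mem.1 i m).1 (hw.nonneg i m)) ⟨j, mem_univ j, ?_⟩
  rw [h1]; simpa using hi

/-- The agents with utility at most `t` share all the items liked by one of them. -/
theorem sum_util_le (hw : IsDichotomous w) (he : IsTransferStable w e) {y : Mat n}
    (hy : y ∈ assignments n) (t : ℝ) :
    ∑ i with util w e i ≤ t, util w y i ≤ ∑ i with util w e i ≤ t, util w e i := by
  unfold util value
  rw [sum_comm, sum_comm (s := univ.filter fun i => _)]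
  refine sum_le_sum fun j _ => ?_
  -- Compare item by item: an item liked within the group is entirely held at `e` by members who
  -- like it, and any other item is worthless to the group.
  by_cases hj : ∃ k, util w e k ≤ t ∧ w k j = 1
  · obtain ⟨k, hkt, hk⟩ := hj
    have h1 : ∑ i with util w e i ≤ t, e i j * w i j = ∑ i, e i j := by
      rw [sum_filter]
      refine sum_congr rfl fun i _ => ?_
      rcases (he.mem.1 i j).1.eq_or_lt with h0 | h0
      · simp [← h0]
      · obtain ⟨h1, h2⟩ := he.stable i j k h0 hk
        rw [if_pos (h2.trans hkt), h1, mul_one]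
    calc ∑ i with util w e i ≤ t, y i j * w i j ≤ ∑ i with util w e i ≤ t, y i j :=
          sum_le_sum fun i _ => mul_le_of_le_one_right (hy.1 i j).1 (hw.le_one i j)
      _ ≤ ∑ i, y i j := sum_le_sum_of_subset_of_nonneg (filter_subset _ _)
          fun i _ _ => (hy.1 i j).1
      _ = ∑ i, e i j := by rw [hy.2 j, he.mem.2 j]
      _ = _ := h1.symm
  · push Not at hj
    refine sum_le_sum fun i hi => ?_
    have : w i j = 0 := (hw.zero_or_one i j).resolve_right (hj i (mem_filter.1 hi).2)
    simp [this]

/-- Agents above `t` at `e` already contribute the maximum `t`; the others are covered by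
`sum_util_le`. -/
theorem sum_min_le (hw : IsDichotomous w) (he : IsTransferStable w e) {y : Mat n}
    (hy : y ∈ assignments n) (t : ℝ) :
    ∑ i, min (util w y i) t ≤ ∑ i, min (util w e i) t := by
  rw [← sum_filter_add_sum_filter_not univ (fun i => util w e i ≤ t),
    ← sum_filter_add_sum_filter_not univ (fun i => util w e i ≤ t)
      (fun i => min (util w e i) t)]
  refine add_le_add ?_ ?_
  · refine (sum_le_sum fun i _ => min_le_left _ _).trans ((he.sum_util_le hw hy t).trans ?_)
    exact sum_le_sum fun i hi => (min_eq_left (mem_filter.1 hi).2).ge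
  · refine sum_le_sum fun i hi => ?_
    rw [min_eq_right (not_le.1 (mem_filter.1 hi).2).le]
    exact min_le_right _ _

end IsTransferStable

theorem util_le_one {w y : Mat n} (hw : IsDichotomous w) (hy : y ∈ balancedAssignments n)
    (i : Fin n) : util w y i ≤ 1 :=
  (hw.value_le_size (fun j => (hy.1.1 i j).1) i).trans_eq (hy.2 i)

/-- The profile of a transfer stable assignment, truncated at `1`. -/
def truncUtil (w e : Mat n) (i : Fin n) : ℝ := min (util w e i) 1

namespace IsTransferStable

variable {w e : Mat n}

theorem sum_min_truncUtil_le (hw : IsDichotomous w) (he : IsTransferStable w e) {y : Mat n}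
    (hy : y ∈ balancedAssignments n) (t : ℝ) :
    ∑ i, min (util w y i) t ≤ ∑ i, min (truncUtil w e i) t := by
  have := he.sum_min_le hw hy.1 (min 1 t)
  simp only [truncUtil, min_assoc]
  refine le_trans (sum_le_sum fun i _ => ?_) this
  rw [← min_assoc, min_eq_left (util_le_one hw hy i)]

/-- A balanced assignment gives all agents at least their truncated utilities only if it gives
them exactly these. -/
theorem util_eq_of_le (hw : IsDichotomous w) (he : IsTransferStable w e) {y : Mat n}
    (hy : y ∈ balancedAssignments n) (h : ∀ i, truncUtil w e i ≤ util w y i) :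
    util w y = truncUtil w e := by
  have h1 := he.sum_min_truncUtil_le hw hy 1
  have h2 : ∀ i, min (util w y i) 1 = util w y i := fun i => min_eq_left (util_le_one hw hy i)
  have h3 : ∀ i, min (truncUtil w e i) 1 = truncUtil w e i := fun i =>
    min_eq_left (min_le_right _ _)
  simp only [h2, h3] at h1
  have h4 := (sum_eq_sum_iff_of_le fun i (_ : i ∈ univ) => h i).1
    (le_antisymm (sum_le_sum fun i _ => h i) h1)
  exact funext fun i => (h4 i (mem_univ i)).symm

end IsTransferStable

end Stable

/-! ### Demand inequalities and competitive prices -/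

section Prices

variable {n : ℕ}

theorem value_eq_of_size_eq_one {f g a : Fin n → ℝ} {α β : ℝ} (hf : ∀ j, f j = β + (α - β) * g j)
    (ha : size a = 1) : value f a = β + (α - β) * value g a := by
  unfold size at ha
  simp only [value, hf, mul_add, sum_add_distrib, ← sum_mul, ha, mul_sum, one_mul]
  congr 1
  exact sum_congr rfl fun j _ => by ring

/-- HZ demand compares only allocations of size one, and on these the two values differ by an
increasing affine map. -/
theorem isCheapestDemand_congr {f g p a : Fin n → ℝ} {α β : ℝ} (hlt : β < α)
    (hf : ∀ j, f j = β + (α - β) * g j) :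
    IsCheapestDemand (balancedAllocations n) f p a ↔
      IsCheapestDemand (balancedAllocations n) g p a := by
  have key : ∀ b ∈ balancedAllocations n, ∀ c ∈ balancedAllocations n,
      (value f b ≤ value f c ↔ value g b ≤ value g c) := by
    intro b hb c hc
    rw [value_eq_of_size_eq_one hf hb.2, value_eq_of_size_eq_one hf hc.2, add_le_add_iff_left,
      mul_le_mul_iff_right₀ (sub_pos.2 hlt)]
  constructor
  · intro h
    exact ⟨h.mem, h.affordable, fun b hb hc => (key b hb a h.mem).1 (h.optimal b hb hc),
      fun b hb hv => h.cheapest b hb ((key a h.mem b hb).2 hv)⟩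
  · intro h
    exact ⟨h.mem, h.affordable, fun b hb hc => (key b hb a h.mem).2 (h.optimal b hb hc),
      fun b hb hv => h.cheapest b hb ((key a h.mem b hb).1 hv)⟩

/-- `l` units of item `j` and `m` units of item `k`. -/
def bundle (l : ℝ) (j : Fin n) (m : ℝ) (k : Fin n) : Fin n → ℝ :=
  fun i => (if i = j then l else 0) + (if i = k then m else 0)

theorem cost_bundle (p : Fin n → ℝ) (l : ℝ) (j : Fin n) (m : ℝ) (k : Fin n) :
    cost p (bundle l j m k) = l * p j + m * p k := by
  simp only [cost, bundle, mul_add, sum_add_distrib, mul_ite, mul_zero, sum_ite_eq', mem_univ,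
    if_true]
  ring

theorem value_bundle (f : Fin n → ℝ) (l : ℝ) (j : Fin n) (m : ℝ) (k : Fin n) :
    value f (bundle l j m k) = l * f j + m * f k := by
  simp [value, bundle, add_mul, sum_add_distrib]

theorem bundle_nonneg {l m : ℝ} (hl : 0 ≤ l) (hm : 0 ≤ m) (j k i : Fin n) :
    0 ≤ bundle l j m k i := by
  unfold bundle
  split_ifs <;> linarith

theorem bundle_mem_balancedAllocations {l m : ℝ} (hl : 0 ≤ l) (hm : 0 ≤ m) (h : l + m = 1)
    (j k : Fin n) : bundle l j m k ∈ balancedAllocations n := by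
  refine ⟨fun i => ⟨bundle_nonneg hl hm j k i, ?_⟩, ?_⟩
  · unfold bundle
    split_ifs <;> linarith
  · simp [size, bundle, sum_add_distrib, h]

/-- All assignments have the same total cost, so cost terms cancel when individual demand
inequalities are summed. -/
theorem sum_cost {x : Mat n} (hx : x ∈ assignments n) (p : Fin n → ℝ) :
    ∑ i, cost p (x i) = ∑ j, p j := by
  unfold cost
  rw [sum_comm]
  exact sum_congr rfl fun j _ => by rw [← mul_sum, hx.2 j, mul_one]

theorem balancedAssignments.row_mem {x : Mat n} (hx : x ∈ balancedAssignments n) (i : Fin n) :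
    x i ∈ balancedAllocations n :=
  ⟨hx.1.1 i, hx.2 i⟩

theorem le_cost_of_size_eq_one {p b : Fin n → ℝ} {q : ℝ} (hq : ∀ j, q ≤ p j)
    (hb : b ∈ balancedAllocations n) : q ≤ cost p b := by
  have h : size b = 1 := hb.2
  calc q = ∑ j, q * b j := by rw [← mul_sum]; unfold size at h; rw [h, mul_one]
    _ ≤ cost p b := sum_le_sum fun j _ => mul_le_mul_of_nonneg_right (hq j) (hb.1 j).1

section Demand

variable {w : Mat n} {p : Fin n → ℝ} {q : ℝ} {i m : Fin n}

theorem le_cost_of_liked_price (hw : IsDichotomous w) (hq : ∀ j, q ≤ p j)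
    (hm : ∀ j, w i j = 1 → p m ≤ p j) {b : Fin n → ℝ} (hb : ∀ j, 0 ≤ b j) :
    p m * value (w i) b + q * (size b - value (w i) b) ≤ cost p b := by
  unfold value size cost
  rw [← sum_sub_distrib, mul_sum, mul_sum, ← sum_add_distrib]
  refine sum_le_sum fun j _ => ?_
  have := hb j
  rcases hw.zero_or_one i j with h | h
  · rw [h]; nlinarith [hq j]
  · rw [h]; nlinarith [hm j h]

theorem exists_cheapest_liked (hw : IsDichotomous w) (p : Fin n → ℝ) (i : Fin n) :
    ∃ m, w i m = 1 ∧ ∀ j, w i j = 1 → p m ≤ p j := by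
  obtain ⟨j, hj⟩ := hw.exists_one i
  obtain ⟨m, hm, h⟩ := exists_min_image (univ.filter fun j => w i j = 1) p ⟨j, by simpa using hj⟩
  exact ⟨m, (mem_filter.1 hm).2, fun j hj => h j (by simpa using hj)⟩

/-- A supporting inequality for a demanded balanced allocation, where prices and income are
normalized by subtracting the smallest price `p o`. -/
theorem IsCheapestDemand.value_div_le (hw : IsDichotomous w) {o : Fin n} (ho : ∀ j, p o ≤ p j)
    (ho1 : p o < 1) {a : Fin n → ℝ} (h : IsCheapestDemand (balancedAllocations n) (w i) p a) :
    0 < value (w i) a ∧ ∀ b ∈ balancedAllocations n,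
      value (w i) b / value (w i) a ≤ 1 + (cost p b - cost p a) / (1 - p o) := by
  obtain ⟨m, hm1, hm⟩ := exists_cheapest_liked hw p i
  have hq : 0 < 1 - p o := by linarith
  have hcost : ∀ b ∈ balancedAllocations n,
      p m * value (w i) b + p o * (1 - value (w i) b) ≤ cost p b := fun b hb => by
    have := le_cost_of_liked_price hw ho hm fun j => (hb.1 j).1
    rwa [hb.2] at this
  have hle : ∀ b ∈ balancedAllocations n, value (w i) b ≤ 1 := fun b hb =>
    (hw.value_le_size (fun j => (hb.1 j).1) i).trans_eq hb.2
  have hge : ∀ b ∈ balancedAllocations n, 0 ≤ value (w i) b := fun b hb =>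
    hw.value_nonneg (fun j => (hb.1 j).1) i
  -- If a liked unit is affordable, the agent is saturated and cheapness bounds her spending by `p
  -- m`. Otherwise she can mix the cheapest liked item `m` with the cheapest item `o`; the weight
  -- `l` exhausts the budget.
  rcases le_or_gt (p m) 1 with hpm | hpm
  · have hmem : bundle 1 m 0 m ∈ balancedAllocations n :=
      bundle_mem_balancedAllocations zero_le_one le_rfl (by ring) m m
    have hv : value (w i) (bundle 1 m 0 m) = 1 := by rw [value_bundle, hm1]; ring
    have hc : cost p (bundle 1 m 0 m) = p m := by rw [cost_bundle]; ring
    have ha : value (w i) a = 1 :=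
      le_antisymm (hle a h.mem) (hv ▸ h.optimal _ hmem (hc ▸ hpm))
    have hca : cost p a ≤ p m := hc ▸ h.cheapest _ hmem (by rw [ha, hv])
    refine ⟨by rw [ha]; exact one_pos, fun b hb => ?_⟩
    rw [ha, div_one, ← sub_le_iff_le_add', le_div_iff₀ hq]
    nlinarith [hcost b hb, hle b hb]
  · have hmq : 0 < p m - p o := by linarith
    set l := (1 - p o) / (p m - p o) with hl
    have hl0 : 0 < l := div_pos hq hmq
    have hl1 : l ≤ 1 := (div_le_one hmq).2 (by linarith)
    have hlm : l * (p m - p o) = 1 - p o := div_mul_cancel₀ _ hmq.ne'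
    have hmem : bundle l m (1 - l) o ∈ balancedAllocations n :=
      bundle_mem_balancedAllocations hl0.le (by linarith) (by ring) m o
    have hc : cost p (bundle l m (1 - l) o) = 1 := by rw [cost_bundle]; linarith
    have hv : l ≤ value (w i) (bundle l m (1 - l) o) := by
      rw [value_bundle, hm1]
      nlinarith [hw.nonneg i o]
    have ha : l ≤ value (w i) a := hv.trans (h.optimal _ hmem hc.le)
    refine ⟨hl0.trans_le ha, fun b hb => ?_⟩
    calc value (w i) b / value (w i) a ≤ value (w i) b / l :=
          div_le_div_of_nonneg_left (hge b hb) hl0 ha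
      _ = value (w i) b * (p m - p o) / (1 - p o) := by rw [hl, div_div_eq_mul_div]
      _ ≤ (1 - p o + (cost p b - cost p a)) / (1 - p o) := by
          refine div_le_div_of_nonneg_right ?_ hq.le
          linarith [hcost b hb, h.affordable]
      _ = _ := by rw [add_div, div_self hq.ne']

/-- The budget buys `1 / p m` units of the cheapest liked item `m`, and no bundle yields utility at
less than `p m` per unit. -/
theorem IsCheapestDemand.orthant_value_div_le (hw : IsDichotomous w) (hp : ∀ j, 0 ≤ p j)
    {a : Fin n → ℝ} (h : IsCheapestDemand {a | ∀ j, 0 ≤ a j} (w i) p a) :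
    0 < value (w i) a ∧ ∀ b, (∀ j, 0 ≤ b j) → value (w i) b / value (w i) a ≤ cost p b := by
  obtain ⟨m, hm1, hm⟩ := exists_cheapest_liked hw p i
  have hpm : 0 < p m := by
    -- A free liked item could be demanded without bound.
    refine (hp m).lt_of_ne fun h0 => ?_
    have ha := hw.value_nonneg h.mem i
    have := h.optimal (bundle (value (w i) a + 1) m 0 m) (bundle_nonneg (by linarith) le_rfl m m)
      (by rw [cost_bundle, ← h0]; simp)
    rw [value_bundle, hm1] at this
    linarith
  have ha : 1 / p m ≤ value (w i) a := by
    have := h.optimal (bundle (1 / p m) m 0 m)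
      (bundle_nonneg (one_div_pos.2 hpm).le le_rfl m m)
      (by rw [cost_bundle, one_div_mul_cancel hpm.ne']; simp)
    rwa [value_bundle, hm1, mul_one, zero_mul, add_zero] at this
  refine ⟨(one_div_pos.2 hpm).trans_le ha, fun b hb => ?_⟩
  calc value (w i) b / value (w i) a ≤ value (w i) b / (1 / p m) :=
        div_le_div_of_nonneg_left (hw.value_nonneg hb i) (one_div_pos.2 hpm) ha
    _ = p m * value (w i) b + 0 * (size b - value (w i) b) := by
        rw [div_div_eq_mul_div]; ring
    _ ≤ cost p b := le_cost_of_liked_price hw hp hm hb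

end Demand

theorem IsCEEI.nash {w x : Mat n} (hw : IsDichotomous w) (hx : IsCEEI w x) :
    (∀ i, 0 < util w x i) ∧ ∀ y ∈ assignments n, ∑ i, util w y i / util w x i ≤ n := by
  obtain ⟨hmem, p, hp, h⟩ := hx
  refine ⟨fun i => ((h i).orthant_value_div_le hw hp).1, fun y hy => ?_⟩
  calc ∑ i, util w y i / util w x i ≤ ∑ i, cost p (y i) := sum_le_sum fun i _ =>
        ((h i).orthant_value_div_le hw hp).2 (y i) fun j => (hy.1 i j).1
    _ = ∑ i, cost p (x i) := by rw [sum_cost hy, sum_cost hmem]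
    _ ≤ ∑ _i : Fin n, (1 : ℝ) := sum_le_sum fun i _ => (h i).affordable
    _ = n := by simp

/-- After normalization by the smallest price, the cost differences in the supporting inequalities
sum to zero over the agents. -/
theorem IsHZ.nash {w x : Mat n} (hw : IsDichotomous w) (hx : IsHZ w x) :
    (∀ i, 0 < util w x i) ∧ ∀ y ∈ balancedAssignments n, ∑ i, util w y i / util w x i ≤ n := by
  obtain ⟨hmem, p, hp, h⟩ := hx
  rcases isEmpty_or_nonempty (Fin n) with hn | hn
  · exact ⟨fun i => hn.elim i, fun y _ => by simp⟩
  obtain ⟨o, ho⟩ := Finite.exists_min p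
  have hrow := balancedAssignments.row_mem hmem
  have ho1 : p o ≤ 1 := (le_cost_of_size_eq_one ho (hrow o)).trans (h o).affordable
  -- The normalization degenerates at smallest price `1`; total spending of at most `n` then makes
  -- all prices `1`, and everyone affords a full liked unit.
  rcases ho1.eq_or_lt with ho1 | ho1
  · have hp1 : ∀ j, p j = 1 := by
      have h1 : ∑ j, p j ≤ ∑ _j : Fin n, (1 : ℝ) := by
        rw [← sum_cost hmem.1]
        exact sum_le_sum fun i _ => (h i).affordable
      have h2 := (sum_eq_sum_iff_of_le fun j (_ : j ∈ univ) => ho1 ▸ ho j).1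
        (le_antisymm (sum_le_sum fun j _ => ho1 ▸ ho j) h1)
      exact fun j => (h2 j (mem_univ j)).symm
    have hu : ∀ i, util w x i = 1 := by
      intro i
      obtain ⟨j, hj⟩ := hw.exists_one i
      refine le_antisymm (util_le_one hw hmem i) ?_
      have := (h i).optimal (bundle 1 j 0 j)
        (bundle_mem_balancedAllocations zero_le_one le_rfl (by ring) j j)
        (by rw [cost_bundle, hp1]; simp)
      rwa [value_bundle, hj, mul_one, zero_mul, add_zero] at this
    refine ⟨fun i => by rw [hu]; exact one_pos, fun y hy => ?_⟩
    calc ∑ i, util w y i / util w x i ≤ ∑ _i : Fin n, (1 : ℝ) := sum_le_sum fun i _ => by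
          rw [hu, div_one]; exact util_le_one hw hy i
      _ = n := by simp
  · refine ⟨fun i => ((h i).value_div_le hw ho ho1).1, fun y hy => ?_⟩
    calc ∑ i, util w y i / util w x i
        ≤ ∑ i, (1 + (cost p (y i) - cost p (x i)) / (1 - p o)) := sum_le_sum fun i _ =>
          ((h i).value_div_le hw ho ho1).2 (y i) (balancedAssignments.row_mem hy i)
      _ = n := by
          rw [sum_add_distrib, ← sum_div, sum_sub_distrib, sum_cost hy.1, sum_cost hmem.1]
          simp

/-! ### Equilibrium prices of a transfer stable assignment -/

/-- Prices at which a liked item costs the inverse of the utility of its holders. -/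
structure IsSupportingPrice (w e : Mat n) (p : Fin n → ℝ) : Prop where
  nonneg : ∀ j, 0 ≤ p j
  liked : ∀ i j, w i j = 1 → 1 / util w e i ≤ p j
  held : ∀ i j, 0 < e i j → w i j = 1 → p j = 1 / util w e i
  unliked : ∀ i j, 0 < e i j → w i j = 0 → p j = 0

/-- The price is read off from an arbitrary holder `f j`. The choice is immaterial: stability
equalizes the utilities of all holders of a liked item, and an item unliked by a holder is liked by
nobody. -/
theorem IsTransferStable.exists_isSupportingPrice {w e : Mat n} (hw : IsDichotomous w)
    (he : IsTransferStable w e) : ∃ p, IsSupportingPrice w e p := by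
  choose f hf using exists_holder he.mem
  have hpos := he.util_pos hw
  refine ⟨fun j => w (f j) j * (1 / util w e (f j)), fun j => ?_, fun i j hij => ?_,
    fun i j h0 h1 => ?_, fun i j h0 h1 => ?_⟩
  · exact mul_nonneg (hw.nonneg _ _) (one_div_pos.2 (hpos _)).le
  · obtain ⟨h1, h2⟩ := he.stable (f j) j i (hf j) hij
    rw [h1, one_mul]
    exact one_div_le_one_div_of_le (hpos _) h2
  · obtain ⟨h2, h3⟩ := he.stable (f j) j i (hf j) h1
    obtain ⟨h4, h5⟩ := he.stable i j (f j) h0 h2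
    simp only [h2, one_mul, le_antisymm h3 h5]
  · rcases hw.zero_or_one (f j) j with h | h
    · simp [h]
    · have := (he.stable i j (f j) h0 h).1
      rw [h1] at this
      exact absurd this zero_ne_one

/-- Each agent spends exactly her income, and no bundle gives agent `i` utility at less than `1 /
util w e i` per unit; this bound gives both optimality and cheapness. -/
theorem IsTransferStable.isCEEI {w e : Mat n} (hw : IsDichotomous w)
    (he : IsTransferStable w e) : IsCEEI w e := by
  obtain ⟨p, hp⟩ := he.exists_isSupportingPrice hw
  have hpos := he.util_pos hw
  have hcost : ∀ i, cost p (e i) = 1 := by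
    intro i
    have : ∀ j, p j * e i j = e i j * w i j * (1 / util w e i) := by
      intro j
      rcases (he.mem.1 i j).1.eq_or_lt with h0 | h0
      · simp [← h0]
      · rcases hw.zero_or_one i j with h | h
        · rw [hp.unliked i j h0 h, h]; ring
        · rw [hp.held i j h0 h, h]; ring
    simp only [cost, this, ← sum_mul]
    exact mul_one_div_cancel (hpos i).ne'
  have hge : ∀ i, ∀ b : Fin n → ℝ, (∀ j, 0 ≤ b j) →
      value (w i) b / util w e i ≤ cost p b := by
    intro i b hb
    unfold value cost
    rw [sum_div]
    refine sum_le_sum fun j _ => ?_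
    rcases hw.zero_or_one i j with h | h
    · rw [h, mul_zero, zero_div]; exact mul_nonneg (hp.nonneg j) (hb j)
    · rw [h, mul_one, div_eq_mul_one_div, mul_comm]
      exact mul_le_mul_of_nonneg_right (hp.liked i j h) (hb j)
  refine ⟨he.mem, p, hp.nonneg, fun i => ⟨fun j => (he.mem.1 i j).1, (hcost i).le,
    fun b hb hb1 => ?_, fun b hb hv => ?_⟩⟩
  · exact (div_le_one (hpos i)).1 ((hge i b hb).trans hb1)
  · rw [hcost i]
    exact ((one_le_div (hpos i)).2 hv).trans (hge i b hb)

end Prices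

/-! ### Balancing, and HZ prices for the truncated profile -/

section Balancing

variable {n : ℕ}

/-- Unallocated shares can be used to turn a partial assignment into a balanced one. -/
theorem exists_balanced_ge {x : Mat n} (h0 : ∀ i j, 0 ≤ x i j) (hrow : ∀ i, size (x i) ≤ 1)
    (hcol : ∀ j, ∑ i, x i j ≤ 1) :
    ∃ y ∈ balancedAssignments n, (∀ i j, x i j ≤ y i j) ∧ ∀ i, size (x i) = 1 → y i = x i := by
  -- Row deficits `r` and column deficits `c` have the same total, so the rank-one matrix `r i * c j
  -- / ∑ r` fills both. If the total is `0`, all deficits vanish and division by zero does no harm.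
  set r : Fin n → ℝ := fun i => 1 - size (x i) with hr
  set c : Fin n → ℝ := fun j => 1 - ∑ i, x i j with hc
  have hr0 : ∀ i, 0 ≤ r i := fun i => sub_nonneg.2 (hrow i)
  have hc0 : ∀ j, 0 ≤ c j := fun j => sub_nonneg.2 (hcol j)
  have hrc : ∑ j, c j = ∑ i, r i := by
    simp only [hr, hc, sum_sub_distrib, size]
    rw [sum_comm]
  have hrR : ∀ i, r i * ((∑ i, r i) / ∑ i, r i) = r i := by
    intro i
    rcases eq_or_ne (∑ i, r i) 0 with h | h
    · rw [(sum_eq_zero_iff_of_nonneg fun i _ => hr0 i).1 h i (mem_univ i), zero_mul]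
    · rw [div_self h, mul_one]
  have hcR : ∀ j, c j * ((∑ i, r i) / ∑ i, r i) = c j := by
    intro j
    rcases eq_or_ne (∑ i, r i) 0 with h | h
    · rw [(sum_eq_zero_iff_of_nonneg fun j _ => hc0 j).1 (hrc.trans h) j (mem_univ j), zero_mul]
    · rw [div_self h, mul_one]
  have hadd : ∀ i j, 0 ≤ r i * (c j / ∑ i, r i) := fun i j =>
    mul_nonneg (hr0 i) (div_nonneg (hc0 j) (sum_nonneg fun i _ => hr0 i))
  refine ⟨fun i j => x i j + r i * (c j / ∑ i, r i), ⟨mem_assignments_of_nonneg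
    (fun i j => add_nonneg (h0 i j) (hadd i j)) fun j => ?_, fun i => ?_⟩,
    fun i j => le_add_of_nonneg_right (hadd i j), fun i hi => ?_⟩
  · rw [sum_add_distrib, ← sum_mul, mul_div_left_comm, hcR]
    simp [hc]
  · have : size (fun j => x i j + r i * (c j / ∑ i, r i))
        = size (x i) + r i * ((∑ j, c j) / ∑ i, r i) := by
      simp only [size, sum_add_distrib, ← mul_sum, sum_div]
    rw [this, hrc, hrR]
    simp [hr]
  · funext j
    simp [hr, hi]

/-- An allocation of size more than one can be cut down to one unit, least preferred items
first. -/
theorem exists_cut {w : Mat n} (hw : IsDichotomous w) (i : Fin n) {a : Fin n → ℝ}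
    (ha : ∀ j, 0 ≤ a j) (hsize : 1 < size a) :
    ∃ b : Fin n → ℝ, (∀ j, 0 ≤ b j) ∧ (∀ j, b j ≤ a j) ∧ size b = 1 ∧
      ∀ j k, w i j < w i k → b k < a k → b j = 0 := by
  set d := value (w i) a with hd
  -- With at least one liked unit, drop the rest and rescale. Otherwise keep the liked part and the
  -- fraction `l` of the rest that solves `d + l * (size a - d) = 1`.
  rcases le_or_gt 1 d with h | h
  · have hd0 : 0 < d := by linarith
    refine ⟨fun j => a j * w i j / d, fun j => div_nonneg (mul_nonneg (ha j) (hw.nonneg i j)) hd0.le,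
      fun j => ?_, ?_, fun j k hjk _ => ?_⟩
    · rw [div_le_iff₀ hd0]
      exact mul_le_mul_of_nonneg_left ((hw.le_one i j).trans h) (ha j)
    · unfold size
      rw [← sum_div]
      exact div_self hd0.ne'
    · have : w i j = 0 := (hw.zero_or_one i j).resolve_right fun h1 =>
        absurd (hw.le_one i k) (not_le.2 (h1 ▸ hjk))
      simp [this]
  · have hsd : 0 < size a - d := by linarith
    set l := (1 - d) / (size a - d) with hl
    have hl0 : 0 ≤ l := div_nonneg (by linarith) hsd.le
    have hl1 : l ≤ 1 := (div_le_one hsd).2 (by linarith)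
    refine ⟨fun j => a j * w i j + l * (a j - a j * w i j), fun j => ?_, fun j => ?_, ?_,
      fun j k hjk hlt => ?_⟩
    · rcases hw.zero_or_one i j with h | h
      · simp only [h]; nlinarith [ha j]
      · simp only [h]; linarith [ha j]
    · rcases hw.zero_or_one i j with h | h
      · simp only [h]; nlinarith [ha j]
      · simp only [h]; linarith [ha j]
    · have h1 : ∑ j, a j * w i j = d := rfl
      have h2 : ∑ j, a j = size a := rfl
      unfold size
      rw [sum_add_distrib, ← mul_sum, sum_sub_distrib, h1, h2, hl, div_mul_cancel₀ _ hsd.ne']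
      ring
    · have : w i k = 1 := (hw.zero_or_one i k).resolve_left fun h1 =>
        absurd (hw.nonneg i j) (not_le.2 (h1 ▸ hjk))
      simp [this] at hlt

theorem exists_isBalancing {w : Mat n} (hw : IsDichotomous w) {x : Mat n}
    (hx : x ∈ assignments n) : ∃ y, IsBalancing w x y := by
  have hcut : ∀ i, ∃ b : Fin n → ℝ, (∀ j, 0 ≤ b j) ∧ (∀ j, b j ≤ x i j) ∧ size b ≤ 1 ∧
      (size (x i) ≤ 1 → b = x i) ∧ (1 < size (x i) → size b = 1 ∧
        ∀ j k, w i j < w i k → b k < x i k → b j = 0) := by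
    intro i
    rcases le_or_gt (size (x i)) 1 with h | h
    · exact ⟨x i, fun j => (hx.1 i j).1, fun j => le_rfl, h, fun _ => rfl,
        fun h' => absurd h (not_le.2 h')⟩
    · obtain ⟨b, hb0, hb1, hb2, hb3⟩ := exists_cut hw i (fun j => (hx.1 i j).1) h
      exact ⟨b, hb0, hb1, hb2.le, fun h' => absurd h (not_lt.2 h'), fun _ => ⟨hb2, hb3⟩⟩
  choose b hb0 hb1 hb2 hb3 hb4 using hcut
  obtain ⟨y, hy, hge, heq⟩ := exists_balanced_ge hb0 hb2
    fun j => (sum_le_sum fun i _ => hb1 i j).trans_eq (hx.2 j)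
  refine ⟨y, hy, fun i hi => ?_, fun i hi j => ?_, fun i hi j k hjk hlt => ?_, fun i hi j => ?_⟩
  · rw [heq i (by rw [hb3 i hi.le, hi]), hb3 i hi.le]
  · rw [heq i (hb4 i hi).1]
    exact hb1 i j
  · rw [heq i (hb4 i hi).1] at hlt ⊢
    exact (hb4 i hi).2 j k hjk hlt
  · rw [← hb3 i hi.le]
    exact hge i j

/-- An agent who gives away liked shares has no unliked ones left, so ends with one full liked unit.
-/
theorem IsBalancing.min_util_le {w : Mat n} (hw : IsDichotomous w) {x y : Mat n}
    (h : IsBalancing w x y) (i : Fin n) : min (util w x i) 1 ≤ util w y i := by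
  rcases lt_trichotomy (size (x i)) 1 with hs | hs | hs
  · refine (min_le_left _ _).trans ?_
    unfold util value
    exact sum_le_sum fun j _ =>
      mul_le_mul_of_nonneg_right (h.receives i hs j) (hw.nonneg i j)
  · unfold util
    rw [h.unchanged i hs]
    exact min_le_left _ _
  · by_cases hk : ∃ k, w i k = 1 ∧ y i k < x i k
    · obtain ⟨k, hk1, hk2⟩ := hk
      refine (min_le_right _ _).trans_eq ((h.balanced.2 i).symm.trans (sum_congr rfl fun j _ => ?_))
      rcases hw.zero_or_one i j with h0 | h0
      · rw [h.least_first i hs j k (by rw [h0, hk1]; exact one_pos) hk2, zero_mul]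
      · rw [h0, mul_one]
    · push Not at hk
      refine (min_le_left _ _).trans ?_
      unfold util value
      refine sum_le_sum fun j _ => ?_
      rcases hw.zero_or_one i j with h0 | h0
      · simp [h0]
      · rw [h0, mul_one, mul_one]
        exact hk j h0

theorem IsTransferStable.util_eq_of_isBalancing {w e x y : Mat n} (hw : IsDichotomous w)
    (he : IsTransferStable w e) (hx : util w x = util w e) (h : IsBalancing w x y) :
    util w y = truncUtil w e :=
  he.util_eq_of_le hw h.balanced fun i => by
    have := h.min_util_le hw i
    rwa [hx] at this

/-- Cancelling the supporting prices that are at most `1` makes the holdings at `e` of agents with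
utility at least `1` free, while the others still face prices of at least `1 / util w e i` for liked
items. Each row of `z` costs at least the bound that `e` respects, and the totals agree, so every
agent spends exactly `1` or `0`. -/
theorem IsTransferStable.isHZ {w e z : Mat n} (hw : IsDichotomous w)
    (he : IsTransferStable w e) (hz : z ∈ balancedAssignments n)
    (hu : util w z = truncUtil w e) : IsHZ w z := by
  obtain ⟨p, hp⟩ := he.exists_isSupportingPrice hw
  have hpos := he.util_pos hw
  set q : Fin n → ℝ := fun j => if 1 < p j then p j else 0 with hq
  have hq0 : ∀ j, 0 ≤ q j := fun j => by
    simp only [hq]; split_ifs <;> [exact hp.nonneg j; exact le_rfl]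
  have hcost0 : ∀ b : Fin n → ℝ, (∀ j, 0 ≤ b j) → 0 ≤ cost q b := fun b hb =>
    sum_nonneg fun j _ => mul_nonneg (hq0 j) (hb j)
  have hliked : ∀ i j, util w e i < 1 → w i j = 1 → 1 / util w e i ≤ q j := by
    intro i j hi hj
    have h1 := hp.liked i j hj
    have h2 : 1 < 1 / util w e i := (one_lt_div (hpos i)).2 hi
    simp only [hq, if_pos (h2.trans_le h1)]
    exact h1
  have hge : ∀ i, util w e i < 1 → ∀ b : Fin n → ℝ, (∀ j, 0 ≤ b j) →
      value (w i) b / util w e i ≤ cost q b := by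
    intro i hi b hb
    unfold value cost
    rw [sum_div]
    refine sum_le_sum fun j _ => ?_
    rcases hw.zero_or_one i j with h | h
    · rw [h, mul_zero, zero_div]; exact mul_nonneg (hq0 j) (hb j)
    · rw [h, mul_one, div_eq_mul_one_div, mul_comm]
      exact mul_le_mul_of_nonneg_right (hliked i j hi h) (hb j)
  have hcoste : ∀ i, cost q (e i) ≤ if util w e i < 1 then 1 else 0 := by
    intro i
    have : ∀ j, q j * e i j
        ≤ if util w e i < 1 then e i j * w i j * (1 / util w e i) else 0 := by
      intro j
      rcases (he.mem.1 i j).1.eq_or_lt with h0 | h0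
      · simp [← h0]
      · rcases hw.zero_or_one i j with h | h
        · simp [hq, hp.unliked i j h0 h, h]
        · simp only [hq, hp.held i j h0 h, one_lt_div (hpos i), h]
          split_ifs
          · exact (by ring : _ = _).le
          · simp
    refine (sum_le_sum fun j _ => this j).trans ?_
    split_ifs
    · rw [← sum_mul]
      exact (mul_one_div_cancel (hpos i).ne').le
    · simp
  have hcostz : ∀ i, (if util w e i < 1 then (1 : ℝ) else 0) ≤ cost q (z i) := by
    intro i
    split_ifs with h
    · refine le_trans ?_ (hge i h (z i) fun j => (hz.1.1 i j).1)
      have h1 : value (w i) (z i) = util w e i :=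
        (congrFun hu i).trans (min_eq_left h.le)
      rw [h1, div_self (hpos i).ne']
    · exact hcost0 _ fun j => (hz.1.1 i j).1
  have heq : ∀ i, cost q (z i) = if util w e i < 1 then 1 else 0 := by
    have h1 : ∑ i, cost q (z i) ≤ ∑ i, if util w e i < 1 then (1 : ℝ) else 0 := by
      rw [sum_cost hz.1, ← sum_cost he.mem]
      exact sum_le_sum fun i _ => hcoste i
    have h2 := (sum_eq_sum_iff_of_le fun i (_ : i ∈ univ) => hcostz i).1
      (le_antisymm (sum_le_sum fun i _ => hcostz i) h1)
    exact fun i => (h2 i (mem_univ i)).symm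
  refine ⟨hz, q, hq0, fun i => ?_⟩
  have hval : value (w i) (z i) = min (util w e i) 1 := congrFun hu i
  rcases lt_or_ge (util w e i) 1 with h | h
  · rw [min_eq_left h.le] at hval
    refine ⟨balancedAssignments.row_mem hz i, ?_, fun b hb hb1 => ?_, fun b hb hv => ?_⟩
    · rw [heq i, if_pos h]
    · rw [hval]
      exact (div_le_one (hpos i)).1 ((hge i h b fun j => (hb.1 j).1).trans hb1)
    · rw [heq i, if_pos h]
      rw [hval] at hv
      exact ((one_le_div (hpos i)).2 hv).trans (hge i h b fun j => (hb.1 j).1)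
  · rw [min_eq_right h] at hval
    have h0 : cost q (z i) = 0 := by rw [heq i, if_neg (not_lt.2 h)]
    refine ⟨balancedAssignments.row_mem hz i, ?_, fun b hb _ => ?_, fun b hb _ => ?_⟩
    · rw [h0]; exact zero_le_one
    · rw [hval]
      exact (hw.value_le_size (fun j => (hb.1 j).1) i).trans_eq hb.2
    · rw [h0]
      exact hcost0 b fun j => (hb.1 j).1

end Balancing

/-! ### Extended probabilistic serial -/

section EPS

variable {n : ℕ} {D : Fin n → Finset (Fin n)} {A R C X : Finset (Fin n)} {v : ℝ} {y w e : Mat n}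

theorem mem_likedBy {j : Fin n} : j ∈ likedBy D R C ↔ ∃ i ∈ C, j ∈ D i ∧ j ∈ R := by
  simp [likedBy]

theorem GivesEach.row_eq_zero (h : GivesEach D A R v y) {i : Fin n} (hi : i ∉ A) (j : Fin n) :
    y i j = 0 := by
  by_contra h0
  exact hi (h.supported i j h0).1

theorem GivesEach.card_mul_le (h : GivesEach D A R v y) (hC : C ⊆ A) :
    (C.card : ℝ) * v ≤ (likedBy D R C).card := by
  calc (C.card : ℝ) * v = ∑ i ∈ C, ∑ j, y i j := by
        rw [← nsmul_eq_mul, ← sum_const]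
        exact sum_congr rfl fun i hi => (h.amount i (hC hi)).symm
    _ = ∑ i ∈ C, ∑ j ∈ likedBy D R C, y i j := sum_congr rfl fun i hi =>
        (sum_subset (subset_univ _) fun j _ hj => by
          by_contra h0
          have := mem_inter.1 (h.supported i j h0).2
          exact hj (mem_likedBy.2 ⟨i, hi, this⟩)).symm
    _ = ∑ j ∈ likedBy D R C, ∑ i ∈ C, y i j := sum_comm
    _ ≤ ∑ j ∈ likedBy D R C, (1 : ℝ) := sum_le_sum fun j _ =>
        (sum_le_sum_of_subset_of_nonneg (subset_univ C) fun i _ _ => h.nonneg i j).trans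
          (h.supply j)
    _ = _ := by simp

/-- Shares handed out by the loop are feasible and go to agents who like them. -/
theorem EPSLoop.feasible (h : EPSLoop D A R y) :
    (∀ i j, 0 ≤ y i j) ∧ (∀ i j, y i j ≠ 0 → i ∈ A ∧ j ∈ D i ∩ R) ∧ ∀ j, ∑ i, y i j ≤ 1 := by
  induction h with
  | done R => simp
  | saturate A R y hA hy => exact ⟨hy.nonneg, hy.supported, hy.supply⟩
  | bottleneck A R X y z hA hsat hX hy hz ih =>
    obtain ⟨h0, h1, h2⟩ := ih
    refine ⟨fun i j => add_nonneg (hy.nonneg i j) (h0 i j), fun i j hij => ?_, fun j => ?_⟩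
    · by_cases hyi : y i j = 0
      · have hzi : z i j ≠ 0 := fun h => hij (by simp [hyi, h])
        obtain ⟨h3, h4⟩ := h1 i j hzi
        rw [mem_inter, mem_sdiff] at h4
        exact ⟨(mem_sdiff.1 h3).1, mem_inter.2 ⟨h4.1, h4.2.1⟩⟩
      · obtain ⟨h3, h4⟩ := hy.supported i j hyi
        exact ⟨hX.subset h3, h4⟩
    · simp only [Pi.add_apply, sum_add_distrib]
      -- The two parts never share an item: `y` uses only items liked by `X`, and `z` none of them.
      by_cases hj : j ∈ likedBy D R X
      · have : ∀ i, z i j = 0 := fun i => by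
          by_contra hzi
          exact (mem_sdiff.1 (mem_inter.1 (h1 i j hzi).2).2).2 hj
        simpa [this] using hy.supply j
      · have : ∀ i, y i j = 0 := fun i => by
          by_contra hyi
          obtain ⟨h3, h4⟩ := hy.supported i j hyi
          exact hj (mem_likedBy.2 ⟨i, h3, mem_inter.1 h4⟩)
        simpa [this] using h2 j

/-- The states reached by the loop: the remaining agents are better off at `e` than the other
agents, and the remaining items are those not liked by the latter. -/
structure IsUpperState (w e : Mat n) (A R : Finset (Fin n)) : Prop where
  upper : ∀ i ∈ A, ∀ k ∉ A, util w e k < util w e i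
  items : ∀ j, j ∈ R ↔ ∀ k ∉ A, w k j = 0

namespace IsUpperState

theorem mem_of_holds (hw : IsDichotomous w) (he : IsTransferStable w e)
    (h : IsUpperState w e A R) {i j : Fin n} (hi : i ∈ A) (hij : 0 < e i j) : j ∈ R := by
  refine (h.items j).2 fun k hk => (hw.zero_or_one k j).resolve_right fun hkj => ?_
  exact absurd (h.upper i hi k hk) (not_lt.2 (he.stable i j k hij hkj).2)

/-- Scaling down the liked shares at `e` is a witness, so no matching or flow theorem is needed. -/
theorem exists_givesEach (hw : IsDichotomous w) (hD : ∀ i j, j ∈ D i ↔ w i j = 1)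
    (he : IsTransferStable w e) (h : IsUpperState w e A R) (hC : C ⊆ A) (hv : 0 ≤ v)
    (hle : ∀ i ∈ C, v ≤ util w e i) : ∃ y, GivesEach D C R v y := by
  have hpos := he.util_pos hw
  have he0 := fun i j => (he.mem.1 i j).1
  refine ⟨fun i j => if i ∈ C then e i j * w i j * (v / util w e i) else 0,
    fun i j => ?_, fun i j hij => ?_, fun j => ?_, fun i hi => ?_⟩
  · split_ifs
    · exact mul_nonneg (mul_nonneg (he0 i j) (hw.nonneg i j)) (div_nonneg hv (hpos i).le)
    · exact le_rfl
  · have hi : i ∈ C := by by_contra hi; simp [hi] at hij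
    simp only [if_pos hi] at hij
    have h1 := left_ne_zero_of_mul hij
    have h2 : 0 < e i j := (he0 i j).lt_of_ne' (left_ne_zero_of_mul h1)
    exact ⟨hi, mem_inter.2 ⟨(hD i j).2 ((hw.zero_or_one i j).resolve_left
      (right_ne_zero_of_mul h1)), h.mem_of_holds hw he (hC hi) h2⟩⟩
  · rw [← he.mem.2 j]
    refine sum_le_sum fun i _ => ?_
    split_ifs with hi
    · calc e i j * w i j * (v / util w e i) ≤ e i j * 1 * 1 := by
            refine mul_le_mul (mul_le_mul_of_nonneg_left (hw.le_one i j) (he0 i j))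
              ((div_le_one (hpos i)).2 (hle i hi)) (div_nonneg hv (hpos i).le) ?_
            simpa using he0 i j
        _ = e i j := by ring
    · exact he0 i j
  · simp only [size, if_pos hi]
    rw [← sum_mul]
    exact mul_div_cancel₀ v (hpos i).ne'

theorem sum_util_le_card (hw : IsDichotomous w) (hD : ∀ i j, j ∈ D i ↔ w i j = 1)
    (he : IsTransferStable w e) (h : IsUpperState w e A R) (hC : C ⊆ A) :
    ∑ i ∈ C, util w e i ≤ (likedBy D R C).card := by
  have he0 := fun i j => (he.mem.1 i j).1
  calc ∑ i ∈ C, util w e i = ∑ i ∈ C, ∑ j ∈ likedBy D R C, e i j * w i j :=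
        sum_congr rfl fun i hi => (sum_subset (f := fun j => e i j * w i j) (subset_univ _)
          fun j _ hj => by
          by_contra h0
          have h2 : 0 < e i j := (he0 i j).lt_of_ne' (left_ne_zero_of_mul h0)
          exact hj (mem_likedBy.2 ⟨i, hi, (hD i j).2 ((hw.zero_or_one i j).resolve_left
            (right_ne_zero_of_mul h0)), h.mem_of_holds hw he (hC hi) h2⟩)).symm
    _ = ∑ j ∈ likedBy D R C, ∑ i ∈ C, e i j * w i j := sum_comm
    _ ≤ ∑ j ∈ likedBy D R C, (1 : ℝ) := sum_le_sum fun j _ => by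
        rw [← he.mem.2 j]
        exact (sum_le_sum fun i _ => mul_le_of_le_one_right (he0 i j) (hw.le_one i j)).trans
          (sum_le_sum_of_subset_of_nonneg (subset_univ C) fun i _ _ => he0 i j)
    _ = _ := by simp

variable {s : ℝ}

/-- The lowest agents own all the available items they like: a holder likes the item and is no
better off, hence lies in `A`, as outsiders like no item of `R`, and at level `s`. -/
theorem card_likedBy_lowest (hw : IsDichotomous w) (hD : ∀ i j, j ∈ D i ↔ w i j = 1)
    (he : IsTransferStable w e) (h : IsUpperState w e A R) (hs : ∀ i ∈ A, s ≤ util w e i) :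
    ((likedBy D R (A.filter fun i => util w e i = s)).card : ℝ)
      = (A.filter fun i => util w e i = s).card * s := by
  set L := A.filter fun i => util w e i = s with hL
  have he0 := fun i j => (he.mem.1 i j).1
  have hsum : ∑ i ∈ L, util w e i = L.card * s := by
    rw [← nsmul_eq_mul, ← sum_const]
    exact sum_congr rfl fun i hi => (mem_filter.1 hi).2
  refine le_antisymm ?_ (hsum ▸ h.sum_util_le_card hw hD he (filter_subset _ _))
  rw [← hsum]
  calc ((likedBy D R L).card : ℝ) = ∑ j ∈ likedBy D R L, ∑ i, e i j := by
        simp [he.mem.2]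
    _ = ∑ j ∈ likedBy D R L, ∑ i ∈ L, e i j * w i j := by
        refine sum_congr rfl fun j hj => ?_
        obtain ⟨k, hk, hkj, hjR⟩ := mem_likedBy.1 hj
        rw [← sum_subset (subset_univ L) fun i _ hi => ?_]
        · refine sum_congr rfl fun i _ => ?_
          rcases (he0 i j).eq_or_lt with h0 | h0
          · simp [← h0]
          · rw [(he.stable i j k h0 ((hD k j).1 hkj)).1, mul_one]
        · by_contra h0
          obtain ⟨h1, h2⟩ := he.stable i j k ((he0 i j).lt_of_ne' h0) ((hD k j).1 hkj)
          rw [(mem_filter.1 hk).2] at h2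
          have hiA : i ∈ A := by
            by_contra hiA
            rw [(h.items j).1 hjR i hiA] at h1
            exact zero_ne_one h1
          exact hi (mem_filter.2 ⟨hiA, h2.antisymm (hs i hiA)⟩)
    _ = ∑ i ∈ L, ∑ j ∈ likedBy D R L, e i j * w i j := sum_comm
    _ ≤ ∑ i ∈ L, util w e i := sum_le_sum fun i _ =>
        sum_le_sum_of_subset_of_nonneg (subset_univ _) fun j _ _ =>
          mul_nonneg (he0 i j) (hw.nonneg i j)

theorem ratio_lowest (hw : IsDichotomous w) (hD : ∀ i j, j ∈ D i ↔ w i j = 1)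
    (he : IsTransferStable w e) (h : IsUpperState w e A R) (hs : ∀ i ∈ A, s ≤ util w e i)
    (hne : (A.filter fun i => util w e i = s).Nonempty) :
    ratio D R (A.filter fun i => util w e i = s) = s := by
  have : ((A.filter fun i => util w e i = s).card : ℝ) ≠ 0 := by
    exact_mod_cast hne.card_pos.ne'
  rw [ratio, h.card_likedBy_lowest hw hD he hs, mul_div_cancel_left₀ _ this]

theorem le_ratio (hw : IsDichotomous w) (hD : ∀ i j, j ∈ D i ↔ w i j = 1)
    (he : IsTransferStable w e) (h : IsUpperState w e A R) (hs : ∀ i ∈ A, s ≤ util w e i)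
    (hC : C ⊆ A) (hne : C.Nonempty) : s ≤ ratio D R C := by
  have hc : (0 : ℝ) < C.card := by exact_mod_cast hne.card_pos
  rw [ratio, le_div_iff₀ hc, mul_comm]
  refine le_trans ?_ (h.sum_util_le_card hw hD he hC)
  rw [← nsmul_eq_mul, ← sum_const]
  exact sum_le_sum fun i hi => hs i (hC hi)

/-- The ratio bounds the average utility in `C` from above, so ratio `s` leaves no room above the
minimum `s`. With maximal cardinality this makes the bottleneck unique. -/
theorem subset_lowest_of_ratio_eq (hw : IsDichotomous w) (hD : ∀ i j, j ∈ D i ↔ w i j = 1)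
    (he : IsTransferStable w e) (h : IsUpperState w e A R) (hs : ∀ i ∈ A, s ≤ util w e i)
    (hC : C ⊆ A) (hne : C.Nonempty) (heq : ratio D R C = s) :
    C ⊆ A.filter fun i => util w e i = s := by
  have hc : (0 : ℝ) < C.card := by exact_mod_cast hne.card_pos
  rw [ratio, div_eq_iff hc.ne'] at heq
  have h1 : ∑ i ∈ C, util w e i ≤ ∑ _i ∈ C, s := by
    rw [sum_const, nsmul_eq_mul, mul_comm, ← heq]
    exact h.sum_util_le_card hw hD he hC
  have h2 := (sum_eq_sum_iff_of_le fun i hi => hs i (hC hi)).1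
    (le_antisymm (sum_le_sum fun i hi => hs i (hC hi)) h1)
  exact fun i hi => mem_filter.2 ⟨hC hi, (h2 i hi).symm⟩

theorem isBottleneck_lowest (hw : IsDichotomous w) (hD : ∀ i j, j ∈ D i ↔ w i j = 1)
    (he : IsTransferStable w e) (h : IsUpperState w e A R) (hs : ∀ i ∈ A, s ≤ util w e i)
    (hne : (A.filter fun i => util w e i = s).Nonempty) :
    IsBottleneck D A R (A.filter fun i => util w e i = s) := by
  have hr := h.ratio_lowest hw hD he hs hne
  refine ⟨filter_subset _ _, hne, fun C hC hCne => ?_, fun C hC hCne heq => ?_⟩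
  · rw [hr]; exact h.le_ratio hw hD he hs hC hCne
  · exact card_le_card (h.subset_lowest_of_ratio_eq hw hD he hs hC hCne (heq.trans hr))

theorem eq_lowest_of_isBottleneck (hw : IsDichotomous w) (hD : ∀ i j, j ∈ D i ↔ w i j = 1)
    (he : IsTransferStable w e) (h : IsUpperState w e A R) (hs : ∀ i ∈ A, s ≤ util w e i)
    (hne : (A.filter fun i => util w e i = s).Nonempty) (hX : IsBottleneck D A R X) :
    X = A.filter fun i => util w e i = s := by
  have hr := h.ratio_lowest hw hD he hs hne
  have hrX : ratio D R X = s :=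
    le_antisymm (hr ▸ hX.minimal _ (filter_subset _ _) hne)
      (h.le_ratio hw hD he hs hX.subset hX.nonempty)
  exact eq_of_subset_of_card_le
    (h.subset_lowest_of_ratio_eq hw hD he hs hX.subset hX.nonempty hrX)
    (hX.largest _ (filter_subset _ _) hne (hr.trans hrX.symm))

theorem remove_lowest (hw : IsDichotomous w) (hD : ∀ i j, j ∈ D i ↔ w i j = 1)
    (h : IsUpperState w e A R) (hs : ∀ i ∈ A, s ≤ util w e i)
    (hne : (A.filter fun i => util w e i = s).Nonempty) :
    IsUpperState w e (A \ A.filter fun i => util w e i = s)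
      (R \ likedBy D R (A.filter fun i => util w e i = s)) := by
  set L := A.filter fun i => util w e i = s with hL
  obtain ⟨l, hl⟩ := hne
  obtain ⟨hlA, hls⟩ := mem_filter.1 hl
  refine ⟨fun i hi k hk => ?_, fun j => ⟨fun hj k hk => ?_, fun hj => ?_⟩⟩
  · obtain ⟨hiA, hiL⟩ := mem_sdiff.1 hi
    have hlt : s < util w e i := (hs i hiA).lt_of_ne' fun h0 => hiL (mem_filter.2 ⟨hiA, h0⟩)
    by_cases hkA : k ∈ A
    · have hkL : k ∈ L := by
        by_contra hkL
        exact hk (mem_sdiff.2 ⟨hkA, hkL⟩)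
      rwa [(mem_filter.1 hkL).2]
    · exact h.upper i hiA k hkA
  · obtain ⟨hjR, hjL⟩ := mem_sdiff.1 hj
    by_cases hkA : k ∈ A
    · have hkL : k ∈ L := by
        by_contra hkL
        exact hk (mem_sdiff.2 ⟨hkA, hkL⟩)
      exact (hw.zero_or_one k j).resolve_right fun h1 =>
        hjL (mem_likedBy.2 ⟨k, hkL, (hD k j).2 h1, hjR⟩)
    · exact (h.items j).1 hjR k hkA
  · refine mem_sdiff.2 ⟨(h.items j).2 fun k hk => hj k fun h0 => hk (mem_sdiff.1 h0).1, fun h0 => ?_⟩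
    obtain ⟨k, hk, hkj, -⟩ := mem_likedBy.1 h0
    have := hj k fun h1 => (mem_sdiff.1 h1).2 hk
    rw [(hD k j).1 hkj] at this
    exact one_ne_zero this

theorem exists_lowest (e : Mat n) (hA : A.Nonempty) : ∃ s, (∀ i ∈ A, s ≤ util w e i) ∧
    (A.filter fun i => util w e i = s).Nonempty := by
  obtain ⟨m, hm, hmin⟩ := exists_min_image A (util w e) hA
  exact ⟨_, hmin, m, mem_filter.2 ⟨hm, rfl⟩⟩

/-- The lowest agents like only `s` available items per head. -/
theorem one_le_of_givesEach (hw : IsDichotomous w) (hD : ∀ i j, j ∈ D i ↔ w i j = 1)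
    (he : IsTransferStable w e) (h : IsUpperState w e A R) (hs : ∀ i ∈ A, s ≤ util w e i)
    (hne : (A.filter fun i => util w e i = s).Nonempty) (hy : GivesEach D A R 1 y) : 1 ≤ s := by
  have h1 := hy.card_mul_le (filter_subset (fun i => util w e i = s) A)
  rw [h.card_likedBy_lowest hw hD he hs] at h1
  refine le_of_mul_le_mul_left h1 ?_
  exact_mod_cast hne.card_pos

theorem exists_epsLoop (hw : IsDichotomous w) (hD : ∀ i j, j ∈ D i ↔ w i j = 1)
    (he : IsTransferStable w e) (h : IsUpperState w e A R) : ∃ y, EPSLoop D A R y := by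
  induction A using Finset.strongInduction generalizing R with
  | H A ih =>
    rcases A.eq_empty_or_nonempty with rfl | hA
    · exact ⟨0, .done R⟩
    by_cases hsat : ∃ y, GivesEach D A R 1 y
    · obtain ⟨y, hy⟩ := hsat
      exact ⟨y, .saturate A R y hA hy⟩
    obtain ⟨s, hs, hne⟩ := exists_lowest (w := w) e hA
    have hr := h.ratio_lowest hw hD he hs hne
    obtain ⟨l, hl⟩ := hne
    have hs0 : 0 ≤ s := (mem_filter.1 hl).2 ▸ (he.util_pos hw l).le
    obtain ⟨y, hy⟩ := h.exists_givesEach hw hD he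
      (filter_subset (fun i => util w e i = s) A) hs0 fun i hi => (mem_filter.1 hi).2.ge
    obtain ⟨z, hz⟩ := ih _ (sdiff_ssubset (filter_subset _ _) ⟨l, hl⟩)
      (h.remove_lowest hw hD hs ⟨l, hl⟩)
    exact ⟨y + z, .bottleneck A R _ y z hA hsat (h.isBottleneck_lowest hw hD he hs ⟨l, hl⟩)
      (by rwa [hr]) hz⟩

end IsUpperState

/-- Each bottleneck is the lowest remaining utility level of `e`, and saturation occurs exactly when
that level is at least `1`; hence the truncation. -/
theorem EPSLoop.size_eq (hw : IsDichotomous w) (hD : ∀ i j, j ∈ D i ↔ w i j = 1)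
    (he : IsTransferStable w e) (hy : EPSLoop D A R y) (h : IsUpperState w e A R) :
    ∀ i ∈ A, size (y i) = truncUtil w e i := by
  induction hy with
  | done R => simp
  | saturate A R y hA hy =>
    obtain ⟨s, hs, hne⟩ := IsUpperState.exists_lowest (w := w) e hA
    intro i hi
    rw [hy.amount i hi, truncUtil, min_eq_right]
    exact (h.one_le_of_givesEach hw hD he hs hne hy).trans (hs i hi)
  | bottleneck A R X y z hA hsat hX hy hz ih =>
    obtain ⟨s, hs, hne⟩ := IsUpperState.exists_lowest (w := w) e hA
    have hXL := h.eq_lowest_of_isBottleneck hw hD he hs hne hX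
    have hr : ratio D R X = s := by rw [hXL]; exact h.ratio_lowest hw hD he hs hne
    have hs1 : s ≤ 1 := by
      by_contra! hs1
      exact hsat (h.exists_givesEach hw hD he Subset.rfl zero_le_one
        fun i hi => hs1.le.trans (hs i hi))
    have h' := h.remove_lowest hw hD hs hne
    rw [← hXL] at h'
    intro i hi
    have hadd : size ((y + z) i) = size (y i) + size (z i) := by
      simp [size, sum_add_distrib]
    rw [hadd]
    by_cases hiX : i ∈ X
    · have hz0 : ∀ j, z i j = 0 := fun j => by
        by_contra h0
        exact (mem_sdiff.1 (hz.feasible.2.1 i j h0).1).2 hiX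
      have hsz : size (z i) = 0 := by simp [size, hz0]
      have hi' := hiX
      rw [hXL] at hi'
      rw [hy.amount i hiX, hr, hsz, truncUtil, (mem_filter.1 hi').2, min_eq_left hs1, add_zero]
    · have hsy : size (y i) = 0 := by simp [size, hy.row_eq_zero hiX]
      rw [hsy, zero_add, ih h' i (mem_sdiff.2 ⟨hi, hiX⟩)]

theorem isUpperState_univ (w e : Mat n) : IsUpperState w e univ univ :=
  ⟨fun _ _ _ hk => absurd (mem_univ _) hk, fun _ => by simp⟩

/-- The EPS rule has an outcome. -/
theorem IsTransferStable.exists_eps {u : Mat n} (hw : IsDichotomous w)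
    (hD : ∀ i j, j ∈ topItems u i ↔ w i j = 1) (he : IsTransferStable w e) :
    ∃ x, IsEPS u x := by
  obtain ⟨y, hy⟩ := (isUpperState_univ w e).exists_epsLoop hw hD he
  obtain ⟨h0, -, h2⟩ := hy.feasible
  obtain ⟨x, hx, hge, -⟩ := exists_balanced_ge h0 (fun i => by
    rw [hy.size_eq hw hD he (isUpperState_univ w e) i (mem_univ i)]
    exact min_le_right _ _) h2
  exact ⟨x, hx, y, hy, hge⟩

theorem IsTransferStable.util_eq_of_isEPS {u x : Mat n} (hw : IsDichotomous w)
    (hD : ∀ i j, j ∈ topItems u i ↔ w i j = 1) (he : IsTransferStable w e) (hx : IsEPS u x) :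
    util w x = truncUtil w e := by
  obtain ⟨hb, y, hy, hge⟩ := hx
  refine he.util_eq_of_le hw hb fun i => ?_
  rw [← hy.size_eq hw hD he (isUpperState_univ w e) i (mem_univ i)]
  refine sum_le_sum fun j _ => ?_
  -- Loop shares are liked, so their size counts fully as utility.
  by_cases h0 : y i j = 0
  · rw [h0]; exact mul_nonneg (hb.1.1 i j).1 (hw.nonneg i j)
  · rw [(hD i j).1 (mem_inter.1 (hy.feasible.2.1 i j h0).2).1, mul_one]
    exact hge i j

end EPS

/-! ### Uniqueness of competitive profiles and equivalence of the rules -/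

section Main

variable {n : ℕ} {u w e : Mat n} {α β : Fin n → ℝ}

theorem IsBivalued.isDichotomous (hu : IsBivalued u α β) : IsDichotomous (binaryReduced u α) := by
  refine ⟨fun i j => ?_, fun i => ?_⟩
  · by_cases h : u i j = α i <;> simp [binaryReduced, h]
  · obtain ⟨j, hj⟩ := hu.attained i
    exact ⟨j, by simp [binaryReduced, hj]⟩

theorem IsBivalued.eq_add_mul (hu : IsBivalued u α β) (i j : Fin n) :
    u i j = β i + (α i - β i) * binaryReduced u α i j := by
  rcases hu.mem i j with h | h
  · simp [binaryReduced, h]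
  · simp [binaryReduced, h, (hu.lt i).ne]

theorem IsBivalued.mem_topItems (hu : IsBivalued u α β) (i j : Fin n) :
    j ∈ topItems u i ↔ binaryReduced u α i j = 1 := by
  have h1 : binaryReduced u α i j = 1 ↔ u i j = α i := by
    by_cases h : u i j = α i <;> simp [binaryReduced, h]
  rw [h1, topItems, mem_filter]
  have hle : ∀ k, u i k ≤ α i := fun k => by
    rcases hu.mem i k with h | h <;> rw [h]
    exact (hu.lt i).le
  obtain ⟨m, hm⟩ := hu.attained i
  exact ⟨fun h => le_antisymm (hle j) (hm ▸ h.2 m), fun h => ⟨mem_univ j, fun k => h ▸ hle k⟩⟩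

theorem IsBivalued.isHZ_iff (hu : IsBivalued u α β) {x : Mat n} :
    IsHZ u x ↔ IsHZ (binaryReduced u α) x := by
  simp only [IsHZ, isCheapestDemand_congr (hu.lt _) (hu.eq_add_mul _)]

theorem IsBivalued.util_eq (hu : IsBivalued u α β) {x : Mat n} (hx : x ∈ balancedAssignments n)
    (i : Fin n) : util u x i = β i + (α i - β i) * util (binaryReduced u α) x i :=
  value_eq_of_size_eq_one (hu.eq_add_mul i) (hx.2 i)

theorem IsTransferStable.isFairest_assignments (hw : IsDichotomous w)
    (he : IsTransferStable w e) : IsFairest (assignments n) w (util w e) where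
  pos := he.util_pos hw
  nash := ((he.isCEEI hw).nash hw).2
  sum_min _ hy := he.sum_min_le hw hy
  nonneg _ hy := util_nonneg hw hy

theorem IsTransferStable.exists_balanced (hw : IsDichotomous w) (he : IsTransferStable w e) :
    ∃ z ∈ balancedAssignments n, util w z = truncUtil w e := by
  obtain ⟨z, hz⟩ := exists_isBalancing hw he.mem
  exact ⟨z, hz.balanced, he.util_eq_of_isBalancing hw rfl hz⟩

/-- The Nash condition comes from the HZ prices of a balanced assignment with this profile. -/
theorem IsTransferStable.isFairest_balancedAssignments (hw : IsDichotomous w)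
    (he : IsTransferStable w e) : IsFairest (balancedAssignments n) w (truncUtil w e) where
  pos i := lt_min (he.util_pos hw i) one_pos
  nash := by
    obtain ⟨z, hz, hu⟩ := he.exists_balanced hw
    rw [← hu]
    exact ((he.isHZ hw hz hu).nash hw).2
  sum_min _ hy := he.sum_min_truncUtil_le hw hy
  nonneg _ hy := util_nonneg hw hy.1

/-- Whatever its prices, an HZ solution satisfies the first-order condition, so it maximizes Nash
welfare, whose optimal profile is unique. -/
theorem IsTransferStable.util_eq_of_isHZ {x : Mat n} (hw : IsDichotomous w)
    (he : IsTransferStable w e) (hx : IsHZ w x) : util w x = truncUtil w e := by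
  obtain ⟨z, hz, hu⟩ := he.exists_balanced hw
  obtain ⟨h1, h2⟩ := hx.nash hw
  refine (he.isFairest_balancedAssignments hw).eq_of_isMNW hz hu ⟨hx.1, fun y hy => ?_⟩
  exact prod_le_prod_of_sum_div_le h1 (util_nonneg hw hy.1) (h2 y hy)

theorem IsTransferStable.util_eq_of_isCEEI {x : Mat n} (hw : IsDichotomous w)
    (he : IsTransferStable w e) (hx : IsCEEI w x) : util w x = util w e := by
  obtain ⟨h1, h2⟩ := hx.nash hw
  refine (he.isFairest_assignments hw).eq_of_isMNW he.mem rfl ⟨hx.1, fun y hy => ?_⟩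
  exact prod_le_prod_of_sum_div_le h1 (util_nonneg hw hy) (h2 y hy)

/-- A rule is equivalent to the HZ rule if it has an outcome and its outcomes are balanced and
give the truncated profile of a transfer stable assignment. -/
theorem IsTransferStable.rulesEquivalent (hu : IsBivalued u α β)
    (he : IsTransferStable (binaryReduced u α) e) {S : Set (Mat n)} (hS : S.Nonempty)
    (h : ∀ y ∈ S, y ∈ balancedAssignments n ∧
      util (binaryReduced u α) y = truncUtil (binaryReduced u α) e) :
    RulesEquivalent u {x | IsHZ u x} S := by
  have hw := hu.isDichotomous
  obtain ⟨z, hz, hzu⟩ := he.exists_balanced hw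
  refine ⟨⟨z, hu.isHZ_iff.2 (he.isHZ hw hz hzu)⟩, hS, fun x hx y hy i => ?_⟩
  have hx' : IsHZ (binaryReduced u α) x := hu.isHZ_iff.1 hx
  rw [hu.util_eq hx'.1, hu.util_eq (h y hy).1, he.util_eq_of_isHZ hw hx', (h y hy).2]

theorem IsTransferStable.rulesEquivalent_balancing (hu : IsBivalued u α β)
    (he : IsTransferStable (binaryReduced u α) e) {P : Mat n → Prop} (hP : P e)
    (h : ∀ x, P x → util (binaryReduced u α) x = util (binaryReduced u α) e) :
    RulesEquivalent u {x | IsHZ u x} {y | ∃ x, P x ∧ IsBalancing (binaryReduced u α) x y} := by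
  have hw := hu.isDichotomous
  obtain ⟨z, hz⟩ := exists_isBalancing hw he.mem
  refine he.rulesEquivalent hu ⟨z, e, hP, hz⟩ ?_
  rintro y ⟨x, hx, hxy⟩
  exact ⟨hxy.balanced, he.util_eq_of_isBalancing hw (h x hx) hxy⟩

end Main

end RandomAssignment

theorem mainTheorem2 (n : ℕ) (u : RandomAssignment.Mat n) (α β : Fin n → ℝ)
    (hu : RandomAssignment.IsBivalued u α β) :
    RandomAssignment.RulesEquivalent u {x | RandomAssignment.IsHZ u x}
      {x | RandomAssignment.IsEPS u x} ∧
    RandomAssignment.RulesEquivalent u {x | RandomAssignment.IsHZ u x}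
      {x | RandomAssignment.IsEgalitarian (RandomAssignment.binaryReduced u α) x} ∧
    RandomAssignment.RulesEquivalent u {x | RandomAssignment.IsHZ u x}
      {x | RandomAssignment.IsLeximin (RandomAssignment.balancedAssignments n)
        (RandomAssignment.binaryReduced u α) x} ∧
    RandomAssignment.RulesEquivalent u {x | RandomAssignment.IsHZ u x}
      {x | RandomAssignment.IsMNW (RandomAssignment.balancedAssignments n)
        (RandomAssignment.binaryReduced u α) x} ∧
    RandomAssignment.RulesEquivalent u {x | RandomAssignment.IsHZ u x}
      {y | ∃ x, RandomAssignment.IsLeximin (RandomAssignment.assignments n)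
          (RandomAssignment.binaryReduced u α) x ∧
        RandomAssignment.IsBalancing (RandomAssignment.binaryReduced u α) x y} ∧
    RandomAssignment.RulesEquivalent u {x | RandomAssignment.IsHZ u x}
      {y | ∃ x, RandomAssignment.IsMNW (RandomAssignment.assignments n)
          (RandomAssignment.binaryReduced u α) x ∧
        RandomAssignment.IsBalancing (RandomAssignment.binaryReduced u α) x y} ∧
    RandomAssignment.RulesEquivalent u {x | RandomAssignment.IsHZ u x}
      {y | ∃ x, RandomAssignment.IsCEEI (RandomAssignment.binaryReduced u α) x ∧
        RandomAssignment.IsBalancing (RandomAssignment.binaryReduced u α) x y} := by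
  have hw := hu.isDichotomous
  obtain ⟨e, he⟩ := RandomAssignment.exists_isTransferStable hw
  obtain ⟨z, hz, hzu⟩ := he.exists_balanced hw
  have hF := he.isFairest_assignments hw
  have hB := he.isFairest_balancedAssignments hw
  refine ⟨he.rulesEquivalent hu (he.exists_eps hw hu.mem_topItems) fun y hy =>
      ⟨hy.1, he.util_eq_of_isEPS hw hu.mem_topItems hy⟩,
    he.rulesEquivalent hu ⟨z, hz, fun y hy => hzu ▸ hB.lorenz hy⟩ fun y hy =>
      ⟨hy.1, hB.eq_of_lorenzDominates hy.1 (hzu ▸ hy.2 z hz)⟩,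
    he.rulesEquivalent hu ⟨z, hB.isLeximin hz hzu⟩ fun y hy =>
      ⟨hy.1, hB.eq_of_isLeximin hz hzu hy⟩,
    he.rulesEquivalent hu ⟨z, hB.isMNW hz hzu⟩ fun y hy =>
      ⟨hy.1, hB.eq_of_isMNW hz hzu hy⟩,
    he.rulesEquivalent_balancing hu (hF.isLeximin he.mem rfl) fun x hx =>
      hF.eq_of_isLeximin he.mem rfl hx,
    he.rulesEquivalent_balancing hu (hF.isMNW he.mem rfl) fun x hx =>
      hF.eq_of_isMNW he.mem rfl hx,
    he.rulesEquivalent_balancing hu (he.isCEEI hw) fun x hx => he.util_eq_of_isCEEI hw hx⟩
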